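/- Let $(M,g)$ be a globally hyperbolic space-time: $M$ is a connected (Hausdorff, second countable) smooth manifold, $g$ is a smooth Lorentzian metric of signature $(-,+,\dots,+)$, time-oriented by a continuous timelike vector field $X$, there are no closed causal curves, and $J^+(p)\cap J^-(q)$ is compact for all $p,q\in M$. A vector $V\in T_xM$ is timelike if $g(V,V)<0$ and causal if $V\neq 0$ and $g(V,V)\le 0$; a causal vector $V$ is future-directed if $g(X(x),V)<0$ and past-directed if $g(X(x),V)>0$. Write $x\ll y$ if there is a future-directed timelike piecewise $C^1$ curve from $x$ to $y$, and $x\le y$ if $x=y$ or there is a future-directed causal piecewise $C^1$ curve from $x$ to $y$; $J^{+}(x)=\{y: x\le y\}$, $J^-(x)=\{y:y\le x\}$. For $x\le y$ let $$d(x,y)=\sup_\gamma\int\sqrt{-g(\dot\gamma,\dot\gamma)}\,dt,$$ the supremum being over all future-directed causal (or constant) curves $\gamma$ from $x$ to $y$. Let $\Gamma\subset M$ be a Cauchy surface, i.e. a set that every inextendible future-directed causal curve meets exactly once, let $I^-[\Gamma]=\{x\in M: x\ll y\text{ for some }y\in\Gamma\}$, let $\phi:\Gamma\to\mathbb R$ be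 locally Lipschitz (with respect to a Riemannian metric $h$ on $M$), and put $$u_\phi(x)=\inf\{\phi(y)-d(x,y): y\in\Gamma,\ x\le y\},\qquad x\in I^-[\Gamma].$$ If $u_\phi$ is differentiable at $x\in I^-[\Gamma]$, then its Lorentzian gradient $\nabla u_\phi(x)\in T_xM$, defined by $g(\nabla u_\phi(x),W)=du_\phi(x)(W)$ for all $W\in T_xM$, is a past-directed timelike vector, and $$g(\nabla u_\phi(x),\nabla u_\phi(x))=-1.$$ -/

import Mathlib

open Set Filter Topology Bundle
open scoped Manifold ContDiff ENNReal NNReal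

noncomputable section

/-- A smooth Lorentzian metric of signature `(-, +, …, +)` on an `(n+1)`-dimensional
smooth manifold. -/
structure LorentzianMetric (n : ℕ) (M : Type*) [TopologicalSpace M]
    [ChartedSpace (EuclideanSpace ℝ (Fin (n + 1))) M] [IsManifold (𝓡 (n + 1)) ∞ M] where
  /-- the bilinear form on each tangent space -/
  val : ∀ x : M, TangentSpace (𝓡 (n + 1)) x →L[ℝ] TangentSpace (𝓡 (n + 1)) x →L[ℝ] ℝ
  symm : ∀ (x : M) (v w : TangentSpace (𝓡 (n + 1)) x), val x v w = val x w v
  /-- signature `(-, +, …, +)`: every tangent space has an orthonormal basis `e₀, …, eₙ` with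
  `g(e₀, e₀) = -1` and `g(eᵢ, eᵢ) = 1` for `i ≥ 1` -/
  signature : ∀ x : M, ∃ e : Module.Basis (Fin (n + 1)) ℝ (TangentSpace (𝓡 (n + 1)) x),
    ∀ i j, val x (e i) (e j) = if i = j then (if i = 0 then -1 else 1) else 0
  smooth : ContMDiff (𝓡 (n + 1))
    ((𝓡 (n + 1)).prod
      𝓘(ℝ, EuclideanSpace ℝ (Fin (n + 1)) →L[ℝ] EuclideanSpace ℝ (Fin (n + 1)) →L[ℝ] ℝ)) ∞
    (fun x ↦ TotalSpace.mk'
      (EuclideanSpace ℝ (Fin (n + 1)) →L[ℝ] EuclideanSpace ℝ (Fin (n + 1)) →L[ℝ] ℝ) x (val x))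

/-- A Lorentzian metric together with a time orientation, given by a continuous timelike
vector field `X`. (Connectedness of `M` is assumed separately.) -/
structure SpaceTime (n : ℕ) (M : Type*) [TopologicalSpace M]
    [ChartedSpace (EuclideanSpace ℝ (Fin (n + 1))) M] [IsManifold (𝓡 (n + 1)) ∞ M]
    extends LorentzianMetric n M where
  /-- the time-orienting vector field -/
  X : ∀ x : M, TangentSpace (𝓡 (n + 1)) x
  X_continuous : Continuous (fun x ↦ (⟨x, X x⟩ : TangentBundle (𝓡 (n + 1)) M))
  X_timelike : ∀ x : M, val x (X x) (X x) < 0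

section Gradient

variable {n : ℕ} {M : Type*} [TopologicalSpace M]
  [ChartedSpace (EuclideanSpace ℝ (Fin (n + 1))) M] [IsManifold (𝓡 (n + 1)) ∞ M]

/-- `v ↦ g(v, ·)` as a linear map from the tangent space to its dual. -/
def LorentzianMetric.flat (g : LorentzianMetric n M) (x : M) :
    TangentSpace (𝓡 (n + 1)) x →ₗ[ℝ] Module.Dual ℝ (TangentSpace (𝓡 (n + 1)) x) where
  toFun v := (g.val x v).toLinearMap
  map_add' v w := by ext z; simp
  map_smul' c v := by ext z; simp

theorem LorentzianMetric.flat_injective (g : LorentzianMetric n M) (x : M) :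
    Function.Injective (g.flat x) := by
  obtain ⟨e, he⟩ := g.signature x
  rw [← LinearMap.ker_eq_bot, LinearMap.ker_eq_bot']
  intro v hv
  refine e.ext_elem fun j ↦ ?_
  have h1 : g.val x (e j) v = 0 := by
    rw [g.symm]
    exact LinearMap.congr_fun hv (e j)
  rw [← e.sum_repr v, map_sum] at h1
  simp only [map_smul, he, smul_eq_mul, mul_ite, mul_zero, Finset.sum_ite_eq,
    Finset.mem_univ, if_true] at h1
  have h2 : e.repr v j = 0 := by
    split_ifs at h1 <;> linarith
  simp [h2]

theorem LorentzianMetric.flat_bijective (g : LorentzianMetric n M) (x : M) :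
    Function.Bijective (g.flat x) := by
  obtain ⟨e, -⟩ := g.signature x
  have : Module.Finite ℝ (TangentSpace (𝓡 (n + 1)) x) := Module.Finite.of_basis e
  refine ⟨g.flat_injective x, ?_⟩
  exact (LinearMap.injective_iff_surjective_of_finrank_eq_finrank
    (Subspace.dual_finrank_eq (K := ℝ) (V := TangentSpace (𝓡 (n + 1)) x)).symm).1
    (g.flat_injective x)

/-- The Lorentzian gradient `∇f(x)`: the vector with `g(∇f(x), w) = df(x)(w)` for all `w`. -/
def LorentzianMetric.grad (g : LorentzianMetric n M) (f : M → ℝ) (x : M) :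
    TangentSpace (𝓡 (n + 1)) x :=
  (LinearEquiv.ofBijective (g.flat x) (g.flat_bijective x)).symm
    (mfderiv (𝓡 (n + 1)) 𝓘(ℝ, ℝ) f x).toLinearMap

theorem LorentzianMetric.val_grad (g : LorentzianMetric n M) (f : M → ℝ) (x : M)
    (w : TangentSpace (𝓡 (n + 1)) x) :
    g.val x (g.grad f x) w = mfderiv (𝓡 (n + 1)) 𝓘(ℝ, ℝ) f x w :=
  LinearMap.congr_fun ((LinearEquiv.ofBijective (g.flat x) (g.flat_bijective x)).apply_symm_apply
    (mfderiv (𝓡 (n + 1)) 𝓘(ℝ, ℝ) f x).toLinearMap) w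

end Gradient

namespace SpaceTime

variable {n : ℕ} {M : Type*} [TopologicalSpace M]
  [ChartedSpace (EuclideanSpace ℝ (Fin (n + 1))) M] [IsManifold (𝓡 (n + 1)) ∞ M]

/-- Timelike vectors: `g(V, V) < 0`. -/
def IsTimelike (S : SpaceTime n M) {x : M} (V : TangentSpace (𝓡 (n + 1)) x) : Prop :=
  S.val x V V < 0

/-- Causal vectors: timelike or lightlike, i.e. nonzero with `g(V, V) ≤ 0`. -/
def IsCausal (S : SpaceTime n M) {x : M} (V : TangentSpace (𝓡 (n + 1)) x) : Prop :=
  V ≠ 0 ∧ S.val x V V ≤ 0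

/-- Future-directed causal vectors. -/
def IsFutureDirected (S : SpaceTime n M) {x : M} (V : TangentSpace (𝓡 (n + 1)) x) : Prop :=
  S.IsCausal V ∧ S.val x (S.X x) V < 0

/-- Past-directed causal vectors. -/
def IsPastDirected (S : SpaceTime n M) {x : M} (V : TangentSpace (𝓡 (n + 1)) x) : Prop :=
  S.IsCausal V ∧ 0 < S.val x (S.X x) V

/-- `γ : [a, b] → M` is a piecewise `C¹` curve all of whose tangent vectors (one-sided ones at
the finitely many break points and at the end points) satisfy `P`. The values of `γ` outside
`[a, b]` are irrelevant. -/
def IsPiecewiseC1With (P : ∀ x : M, TangentSpace (𝓡 (n + 1)) x → Prop)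
    (γ : ℝ → M) (a b : ℝ) : Prop :=
  a < b ∧ ContinuousOn γ (Icc a b) ∧ ∃ B : Finset ℝ, ∀ c d : ℝ, a ≤ c → c < d → d ≤ b →
    (∀ t ∈ B, t ∉ Ioo c d) →
      ContMDiffOn 𝓘(ℝ, ℝ) (𝓡 (n + 1)) 1 γ (Icc c d) ∧
      ∀ t ∈ Icc c d, P (γ t) (mfderivWithin 𝓘(ℝ, ℝ) (𝓡 (n + 1)) γ (Icc c d) t (1 : ℝ))

/-- Future-directed causal (piecewise `C¹`) curves on `[a, b]`. -/
def IsCausalCurve (S : SpaceTime n M) (γ : ℝ → M) (a b : ℝ) : Prop :=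
  IsPiecewiseC1With (fun _ V ↦ S.IsFutureDirected V) γ a b

/-- Future-directed timelike (piecewise `C¹`) curves on `[a, b]`. -/
def IsTimelikeCurve (S : SpaceTime n M) (γ : ℝ → M) (a b : ℝ) : Prop :=
  IsPiecewiseC1With (fun _ V ↦ S.IsTimelike V ∧ S.IsFutureDirected V) γ a b

/-- `p ≪ q`. -/
def Chron (S : SpaceTime n M) (p q : M) : Prop :=
  ∃ (γ : ℝ → M) (a b : ℝ), S.IsTimelikeCurve γ a b ∧ γ a = p ∧ γ b = q

/-- `p ≤ q`: joined by a constant curve or by a future-directed causal curve. -/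
def Caus (S : SpaceTime n M) (p q : M) : Prop :=
  p = q ∨ ∃ (γ : ℝ → M) (a b : ℝ), S.IsCausalCurve γ a b ∧ γ a = p ∧ γ b = q

/-- `I⁻[A]`. -/
def chronPast (S : SpaceTime n M) (A : Set M) : Set M := {p | ∃ s ∈ A, S.Chron p s}

/-- `J⁺(p)`. -/
def causalFuture (S : SpaceTime n M) (p : M) : Set M := {q | S.Caus p q}

/-- `J⁻(p)`. -/
def causalPast (S : SpaceTime n M) (p : M) : Set M := {q | S.Caus q p}

/-- Globally hyperbolic: no causal loops, and all `J⁺(p) ∩ J⁻(q)` are compact. -/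
def IsGloballyHyperbolic (S : SpaceTime n M) : Prop :=
  (∀ (γ : ℝ → M) (a b : ℝ), S.IsCausalCurve γ a b → γ a ≠ γ b) ∧
    ∀ p q : M, IsCompact (S.causalFuture p ∩ S.causalPast q)

/-- Future-directed inextendible causal curves: no past and no future end point. Such a curve
lives on an open interval, which is reparametrized as `ℝ`. -/
def IsInextendibleCausalCurve (S : SpaceTime n M) (γ : ℝ → M) : Prop :=
  (∀ a b : ℝ, a < b → S.IsCausalCurve γ a b) ∧
    (¬ ∃ p : M, Tendsto γ atTop (𝓝 p)) ∧ ¬ ∃ p : M, Tendsto γ atBot (𝓝 p)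

/-- Cauchy surface: every inextendible causal curve meets it exactly once. -/
def IsCauchySurface (S : SpaceTime n M) (Γ : Set M) : Prop :=
  ∀ γ : ℝ → M, S.IsInextendibleCausalCurve γ → ∃! t : ℝ, γ t ∈ Γ

/-- Lorentzian length `∫ √(-g(γ', γ'))` of a piecewise `C¹` causal curve on `[a, b]`. -/
def length (S : SpaceTime n M) (γ : ℝ → M) (a b : ℝ) : ℝ :=
  ∫ t in a..b, Real.sqrt (-S.val (γ t)
    (mfderiv 𝓘(ℝ, ℝ) (𝓡 (n + 1)) γ t (1 : ℝ)) (mfderiv 𝓘(ℝ, ℝ) (𝓡 (n + 1)) γ t (1 : ℝ)))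

/-- Lorentzian distance, for `x ≤ y`: the supremum of the lengths of the future-directed causal
curves from `x` to `y`, and of the constant curve (of length `0`) if `x = y`. Lengths do not
depend on the parametrization, so arbitrary compact parameter intervals are allowed. -/
def dist (S : SpaceTime n M) (x y : M) : ℝ :=
  sSup {l : ℝ | (x = y ∧ l = 0) ∨
    ∃ (γ : ℝ → M) (a b : ℝ), S.IsCausalCurve γ a b ∧ γ a = x ∧ γ b = y ∧ l = S.length γ a b}

/-- `u_φ(x) = inf {φ(y) - d(x, y) : y ∈ Γ, x ≤ y}`. -/
def uSol (S : SpaceTime n M) (Γ : Set M) (φ : Γ → ℝ) (x : M) : ℝ :=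
  sInf {r : ℝ | ∃ y : Γ, (y : M) ∈ S.causalFuture x ∧ r = φ y - S.dist x y}

end SpaceTime

/-- The distance `d_h` of a Riemannian metric `h`: the infimum of the `h`-lengths of paths. -/
def riemDist {n : ℕ} {M : Type*} [TopologicalSpace M]
    [ChartedSpace (EuclideanSpace ℝ (Fin (n + 1))) M] [IsManifold (𝓡 (n + 1)) ∞ M]
    (h : ContMDiffRiemannianMetric (𝓡 (n + 1)) ∞ (EuclideanSpace ℝ (Fin (n + 1)))
      (fun x : M ↦ TangentSpace (𝓡 (n + 1)) x)) (x y : M) : ℝ≥0∞ :=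
  letI : RiemannianBundle (fun x : M ↦ TangentSpace (𝓡 (n + 1)) x) := ⟨h.toRiemannianMetric⟩
  Manifold.riemannianEDist (𝓡 (n + 1)) x y

/-- `φ ∈ Lip_loc(Γ)` with respect to the Riemannian metric `h`. -/
def IsLocLipschitz {n : ℕ} {M : Type*} [TopologicalSpace M]
    [ChartedSpace (EuclideanSpace ℝ (Fin (n + 1))) M] [IsManifold (𝓡 (n + 1)) ∞ M]
    (h : ContMDiffRiemannianMetric (𝓡 (n + 1)) ∞ (EuclideanSpace ℝ (Fin (n + 1)))
      (fun x : M ↦ TangentSpace (𝓡 (n + 1)) x)) (Γ : Set M) (φ : Γ → ℝ) : Prop :=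
  ∀ y : Γ, ∃ U ∈ 𝓝 (y : M), ∃ K : ℝ≥0, ∀ z w : Γ, (z : M) ∈ U → (w : M) ∈ U →
    ENNReal.ofReal |φ z - φ w| ≤ K * riemDist h (z : M) (w : M)

end

/-! Write `u` for `uSol`, `G` for its gradient at `x` and `l = g(G, ·)`. No geodesics or maximizing
curves are needed: `u` satisfies a dynamic programming principle, whose two halves give the two
inequalities for `g(G, G)`.

Upper bound. A short segment from `x` with future timelike velocity `V` can be put in front of any
competitor for its end point, so `u` grows along it by at least its length. Hence `√(-g(V, V)) ≤ l
V` (`sqrt_le_fderiv_uSol`). Taking `V = X` shows that `G` is past-directed, and Lorentzian linear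
algebra turns the whole family of inequalities into `g(G, G) ≤ -1`
(`IsLorentzForm.le_neg_one_of_forall`).

Lower bound. If `g(G, G) < -1`, the reverse Cauchy–Schwarz inequality makes `l` exceed the
Lorentzian norm by a fixed factor on future causal vectors, and this persists near `x`
(`exists_length_le_of_lt_neg_one`). A nearly optimal curve from `x`, followed until it leaves a
small ball, gains too little length to account for the linear growth of `u`
(`neg_one_le_of_hasFDerivAt_uSol`).

Both halves need the suprema and the infimum to be genuine, that is, length minus final cost bounded
over causal curves from a point to `Γ` (`exists_forall_length_sub_le`). Otherwise, closedness of the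
causal relation lets the unboundedness be passed on along a causal chain without limit. The chain
crosses `Γ`, and beyond `Γ` no causal curve returns to it. -/

set_option linter.unusedSectionVars false

/-! ### Continuous families of linear and bilinear forms -/

theorem eventually_abs_clm_apply_sub_le {F α : Type*} [NormedAddCommGroup F] [NormedSpace ℝ F]
    [TopologicalSpace α] {L : α → F →L[ℝ] ℝ} {c : α} (hL : ContinuousAt L c) {ε : ℝ}
    (hε : 0 < ε) : ∀ᶠ p in 𝓝 c, ∀ v, |L p v - L c v| ≤ ε * ‖v‖ := by
  filter_upwards [hL.eventually (eventually_norm_sub_lt (L c) hε)] with p hp v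
  have := (L p - L c).le_opNorm v
  simp only [sub_apply, Real.norm_eq_abs] at this
  refine this.trans ?_
  gcongr

set_option synthInstance.maxHeartbeats 200000 in
theorem eventually_abs_clm_apply₂_sub_le {F α : Type*} [NormedAddCommGroup F] [NormedSpace ℝ F]
    [TopologicalSpace α] {G : α → F →L[ℝ] F →L[ℝ] ℝ} {c : α} (hG : ContinuousAt G c) {ε : ℝ}
    (hε : 0 < ε) : ∀ᶠ p in 𝓝 c, ∀ v, |G p v v - G c v v| ≤ ε * ‖v‖ ^ 2 := by
  filter_upwards [hG.eventually (eventually_norm_sub_lt (G c) hε)] with p hp v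
  have := (G p - G c).le_opNorm₂ v v
  simp only [sub_apply, Real.norm_eq_abs] at this
  refine this.trans ?_
  rw [mul_assoc, ← pow_two]
  gcongr

/-! ### Tangent vectors and the metric in chart coordinates -/

section ChartCoordinates

variable {n : ℕ} {M : Type*} [TopologicalSpace M]
  [ChartedSpace (EuclideanSpace ℝ (Fin (n + 1))) M] [IsManifold (𝓡 (n + 1)) ∞ M]

/-- The coordinates, in the chart at `c`, of tangent vectors at `p`. -/
noncomputable def chartCoord (c p : M) :
    TangentSpace (𝓡 (n + 1)) p →L[ℝ] EuclideanSpace ℝ (Fin (n + 1)) :=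
  (trivializationAt (EuclideanSpace ℝ (Fin (n + 1))) (TangentSpace (𝓡 (n + 1))) c
    ).continuousLinearMapAt ℝ p

theorem chartCoord_self (c : M) (v : TangentSpace (𝓡 (n + 1)) c) :
    chartCoord c c v = (v : EuclideanSpace ℝ (Fin (n + 1))) := by
  unfold chartCoord
  rw [TangentBundle.continuousLinearMapAt_trivializationAt_eq_core (mem_chart_source _ c)]
  exact (tangentBundleCore (𝓡 (n + 1)) M).coordChange_self (achart _ c) c
    (mem_chart_source _ c) v

theorem chartCoord_eq_mfderiv {c p : M}
    (hp : p ∈ (chartAt (EuclideanSpace ℝ (Fin (n + 1))) c).source) :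
    chartCoord (n := n) c p = mfderiv (𝓡 (n + 1)) 𝓘(ℝ, EuclideanSpace ℝ (Fin (n + 1)))
      (extChartAt (𝓡 (n + 1)) c) p :=
  TangentBundle.continuousLinearMapAt_trivializationAt hp

/-- The metric near `c`, in the coordinates at `c`, is close to the metric at `c`. -/
theorem LorentzianMetric.exists_coord_repr (g : LorentzianMetric n M) (c : M) :
    ∃ G : M → (EuclideanSpace ℝ (Fin (n + 1)) →L[ℝ] EuclideanSpace ℝ (Fin (n + 1)) →L[ℝ] ℝ),
      ContinuousAt G c ∧ ∀ p ∈ (chartAt (EuclideanSpace ℝ (Fin (n + 1))) c).source,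
        ∀ V W : TangentSpace (𝓡 (n + 1)) p,
          g.val p V W = G p (chartCoord c p V) (chartCoord c p W) := by
  have hg := g.smooth.continuous.continuousAt (x := c)
  rw [continuousAt_hom_bundle] at hg
  refine ⟨_, hg.2, fun p hp V W ↦ ?_⟩
  have hp' : p ∈ (trivializationAt (EuclideanSpace ℝ (Fin (n + 1)))
      (TangentSpace (𝓡 (n + 1)) : M → Type _) c).baseSet := by
    simpa using hp
  rw [inCoordinates_apply_eq₂ hp' hp' (by simp)]
  have h1 := fun v ↦ Trivialization.symmL_continuousLinearMapAt (R := ℝ) _ hp' v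
  have h2 : ∀ r : ℝ, Trivialization.linearMapAt ℝ
      (trivializationAt ℝ (Bundle.Trivial M ℝ) c) p r = r := by simp
  have h3 : ∀ V, (trivializationAt (EuclideanSpace ℝ (Fin (n + 1)))
      (TangentSpace (𝓡 (n + 1)) : M → Type _) c).symm p (chartCoord c p V) = V :=
    fun V ↦ (Trivialization.symmL_apply _ hp' _).symm.trans (h1 V)
  rw [h3 V, h3 W]
  exact (h2 _).symm

theorem SpaceTime.continuousAt_chartCoord_X (S : SpaceTime n M) (c : M) :
    ContinuousAt (fun p ↦ chartCoord c p (S.X p)) c := by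
  have hX := S.X_continuous.continuousAt (x := c)
  rw [FiberBundle.continuousAt_totalSpace] at hX
  refine hX.2.congr ?_
  filter_upwards [chart_source_mem_nhds (EuclideanSpace ℝ (Fin (n + 1))) c] with p hp
  unfold chartCoord
  rw [Trivialization.continuousLinearMapAt_apply, Trivialization.linearMapAt_apply,
    if_pos (by simpa using hp)]

/-- The metric at `c`, as a bilinear form on the model space. -/
noncomputable def LorentzianMetric.form (g : LorentzianMetric n M) (c : M) :
    EuclideanSpace ℝ (Fin (n + 1)) →L[ℝ] EuclideanSpace ℝ (Fin (n + 1)) →L[ℝ] ℝ :=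
  g.val c

/-- The time-orienting vector at `c`, as a vector of the model space. -/
def SpaceTime.vec (S : SpaceTime n M) (c : M) : EuclideanSpace ℝ (Fin (n + 1)) := S.X c

/-- Continuity of the metric and of the time orientation, in quantitative form. Local estimates on
causal vectors go through these two inequalities, which compare everything with constant forms on
the model space. -/
theorem SpaceTime.eventually_val_sub_le (S : SpaceTime n M) (c : M) {ε : ℝ} (hε : 0 < ε) :
    ∀ᶠ p in 𝓝 c, ∀ V : TangentSpace (𝓡 (n + 1)) p,
      |S.val p V V - S.form c (chartCoord c p V) (chartCoord c p V)| ≤ ε * ‖chartCoord c p V‖ ^ 2 ∧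
      |S.val p (S.X p) V - S.form c (S.vec c) (chartCoord c p V)| ≤ ε * ‖chartCoord c p V‖ := by
  obtain ⟨G, hG, hGe⟩ := S.toLorentzianMetric.exists_coord_repr c
  have hc : S.form c = G c := by
    ext v w
    have := hGe c (mem_chart_source _ c) v w
    exact this.trans (congrArg₂ (fun v w ↦ G c v w) (chartCoord_self c v) (chartCoord_self c w))
  have hX : chartCoord c c (S.X c) = S.vec c := chartCoord_self c _
  have h1 := eventually_abs_clm_apply_sub_le (hG.clm_apply (S.continuousAt_chartCoord_X c)) hε
  filter_upwards [eventually_abs_clm_apply₂_sub_le hG hε, h1,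
    chart_source_mem_nhds (EuclideanSpace ℝ (Fin (n + 1))) c] with p hp1 hp2 hp V
  rw [hX] at hp2
  rw [hGe p hp, hGe p hp, hc]
  exact ⟨hp1 _, hp2 _⟩

theorem hasDerivWithinAt_extChartAt_comp {c : M} {γ : ℝ → M} {s : Set ℝ} {t : ℝ}
    (hγ : MDifferentiableWithinAt 𝓘(ℝ, ℝ) (𝓡 (n + 1)) γ s t)
    (ht : γ t ∈ (chartAt (EuclideanSpace ℝ (Fin (n + 1))) c).source) :
    HasDerivWithinAt (fun τ ↦ extChartAt (𝓡 (n + 1)) c (γ τ))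
      (chartCoord c (γ t) (mfderivWithin 𝓘(ℝ, ℝ) (𝓡 (n + 1)) γ s t (1 : ℝ))) s t := by
  have h1 := (mdifferentiableAt_extChartAt (I := 𝓡 (n + 1)) ht).hasMFDerivAt
  have h2 := h1.comp_hasMFDerivWithinAt t hγ.hasMFDerivWithinAt
  rw [← chartCoord_eq_mfderiv ht] at h2
  let L : ℝ →L[ℝ] EuclideanSpace ℝ (Fin (n + 1)) :=
    (chartCoord c (γ t)).comp (mfderivWithin 𝓘(ℝ, ℝ) (𝓡 (n + 1)) γ s t)
  have h3 : HasFDerivWithinAt (fun τ ↦ extChartAt (𝓡 (n + 1)) c (γ τ)) L s t :=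
    hasMFDerivWithinAt_iff_hasFDerivWithinAt.1 h2
  exact h3.hasDerivWithinAt

/-- The velocity, in coordinates, of a curve given in the chart at `c`. -/
theorem chartCoord_mfderivWithin_symm_comp {c : M}
    {η : ℝ → EuclideanSpace ℝ (Fin (n + 1))} {s : Set ℝ} {t : ℝ}
    {v : EuclideanSpace ℝ (Fin (n + 1))}
    (hs : UniqueDiffWithinAt ℝ s t) (hη : HasDerivWithinAt η v s t) (hts : t ∈ s)
    (ht : ∀ τ ∈ s, η τ ∈ (extChartAt (𝓡 (n + 1)) c).target) :
    chartCoord c ((extChartAt (𝓡 (n + 1)) c).symm (η t))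
      (mfderivWithin 𝓘(ℝ, ℝ) (𝓡 (n + 1))
        (fun τ ↦ (extChartAt (𝓡 (n + 1)) c).symm (η τ)) s t (1 : ℝ)) = v := by
  have hsrc : (extChartAt (𝓡 (n + 1)) c).symm (η t) ∈
      (chartAt (EuclideanSpace ℝ (Fin (n + 1))) c).source := by
    have := (extChartAt (𝓡 (n + 1)) c).map_target (ht t hts)
    rwa [extChartAt_source] at this
  have hmd : MDifferentiableWithinAt 𝓘(ℝ, ℝ) (𝓡 (n + 1))
      (fun τ ↦ (extChartAt (𝓡 (n + 1)) c).symm (η τ)) s t := by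
    have h1 := (contMDiffOn_extChartAt_symm (I := 𝓡 (n + 1)) (n := 1) c).mdifferentiableOn
      one_ne_zero (η t) (ht t hts)
    exact h1.comp t hη.hasFDerivWithinAt.differentiableWithinAt.mdifferentiableWithinAt ht
  have h := hasDerivWithinAt_extChartAt_comp (c := c) hmd hsrc
  refine hs.eq_deriv _ h (hη.congr ?_ ?_)
  · intro τ hτ
    exact (extChartAt (𝓡 (n + 1)) c).right_inv (ht τ hτ)
  · exact (extChartAt (𝓡 (n + 1)) c).right_inv (ht t hts)

/-- The tangent map of a `C¹` curve is continuous into the tangent bundle. This is what makes the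
Lorentzian speed integrable. -/
theorem continuousOn_val_mfderivWithin (g : LorentzianMetric n M) {γ : ℝ → M} {a b : ℝ}
    (hab : a < b) (hγ : ContMDiffOn 𝓘(ℝ, ℝ) (𝓡 (n + 1)) 1 γ (Icc a b)) :
    ContinuousOn (fun t ↦ g.val (γ t)
      (mfderivWithin 𝓘(ℝ, ℝ) (𝓡 (n + 1)) γ (Icc a b) t (1 : ℝ))
      (mfderivWithin 𝓘(ℝ, ℝ) (𝓡 (n + 1)) γ (Icc a b) t (1 : ℝ))) (Icc a b) := by
  have hu : UniqueMDiffOn 𝓘(ℝ, ℝ) (Icc a b) := (uniqueDiffOn_Icc hab).uniqueMDiffOn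
  have h1 := hγ.continuousOn_tangentMapWithin le_rfl hu
  have h2 : ContinuousOn (fun t : ℝ ↦ (⟨t, (1 : ℝ)⟩ : TangentBundle 𝓘(ℝ, ℝ) ℝ)) (Icc a b) := by
    have : Continuous (fun t : ℝ ↦ (tangentBundleModelSpaceHomeomorph 𝓘(ℝ, ℝ)).symm (t, (1 : ℝ))) :=
      (tangentBundleModelSpaceHomeomorph 𝓘(ℝ, ℝ)).symm.continuous.comp (by fun_prop)
    exact this.continuousOn
  have h3 : ContinuousOn (fun t ↦ TotalSpace.mk' (EuclideanSpace ℝ (Fin (n + 1))) (γ t)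
      (mfderivWithin 𝓘(ℝ, ℝ) (𝓡 (n + 1)) γ (Icc a b) t (1 : ℝ))) (Icc a b) :=
    h1.comp h2 (fun t ht ↦ ht)
  intro t ht
  have h4 : ContinuousWithinAt (fun t ↦ TotalSpace.mk'
      (EuclideanSpace ℝ (Fin (n + 1)) →L[ℝ] EuclideanSpace ℝ (Fin (n + 1)) →L[ℝ] ℝ)
      (E := fun x : M ↦ TangentSpace (𝓡 (n + 1)) x →L[ℝ] TangentSpace (𝓡 (n + 1)) x →L[ℝ] ℝ)
      (γ t) (g.val (γ t))) (Icc a b) t :=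
    g.smooth.continuous.continuousAt.comp_continuousWithinAt (hγ.continuousOn t ht)
  have h5 := ContinuousWithinAt.clm_bundle_apply₂ (F₁ := EuclideanSpace ℝ (Fin (n + 1)))
    (F₂ := EuclideanSpace ℝ (Fin (n + 1))) (F₃ := ℝ) (E₃ := Bundle.Trivial M ℝ)
    h4 (h3 t ht) (h3 t ht)
  rw [FiberBundle.continuousWithinAt_totalSpace] at h5
  exact h5.2

end ChartCoordinates

/-! ### Linear algebra of Lorentzian forms -/

section LorentzForm

variable {F : Type*} [NormedAddCommGroup F] [NormedSpace ℝ F]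

/-- A symmetric bilinear form which is positive definite on the orthogonal complement of each
vector on which it is negative. -/
def IsLorentzForm (B : F →L[ℝ] F →L[ℝ] ℝ) : Prop :=
  (∀ v w, B v w = B w v) ∧ ∀ T v, B T T < 0 → B T v = 0 → v ≠ 0 → 0 < B v v

variable {B : F →L[ℝ] F →L[ℝ] ℝ}

theorem IsLorentzForm.nonneg_of_orthogonal (hB : IsLorentzForm B) {T v : F} (hT : B T T < 0)
    (h : B T v = 0) : 0 ≤ B v v := by
  rcases eq_or_ne v 0 with rfl | hv
  · simp
  · exact (hB.2 T v hT h hv).le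

/-- The reverse Cauchy–Schwarz inequality. -/
theorem IsLorentzForm.mul_le_sq (hB : IsLorentzForm B) {T : F} (hT : B T T < 0) (v : F) :
    B T T * B v v ≤ B T v ^ 2 := by
  -- This is the projection of `v` orthogonally to `T`, scaled by `B T T` to avoid a division.
  have h1 := hB.nonneg_of_orthogonal (T := T) (v := B T T • v - B T v • T) hT (by
    simp; ring)
  have h2 : B (B T T • v - B T v • T) (B T T • v - B T v • T) =
      B T T * (B T T * B v v - B T v ^ 2) := by
    simp [hB.1 v T]; ring
  rw [h2] at h1
  nlinarith [nonpos_of_mul_nonneg_right h1 hT]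

/-- Otherwise some `N + l • X` with `l ≥ 0` is orthogonal to `v`; it is timelike because `X` and `N`
lie in the same cone, which forces `v` to be spacelike. -/
theorem IsLorentzForm.neg_of_causal (hB : IsLorentzForm B) {X N v : F} (hX : B X X < 0)
    (hN : B N N < 0) (hXN : B X N < 0) (hv : v ≠ 0) (hvv : B v v ≤ 0) (hXv : B X v ≤ 0) :
    B N v < 0 := by
  have hne : B X v ≠ 0 := fun h ↦ (hB.2 X v hX h hv).not_ge hvv
  have hXv' : B X v < 0 := lt_of_le_of_ne hXv hne
  by_contra! hNv
  set l := B N v / (-B X v) with hl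
  have hl0 : 0 ≤ l := div_nonneg hNv (by linarith)
  refine (hB.2 (N + l • X) v ?_ ?_ hv).not_ge hvv
  · simp [hB.1 N X]
    nlinarith [mul_nonneg hl0 (neg_nonneg.2 hXN.le), mul_nonneg hl0 hl0,
      mul_nonneg (mul_nonneg hl0 hl0) (neg_nonneg.2 hX.le)]
  · simp [hl]
    field_simp
    simp

/-- A future directed timelike vector pairs coercively with vectors in a neighbourhood of the
causal cone. -/
theorem IsLorentzForm.exists_coercive [FiniteDimensional ℝ F] (hB : IsLorentzForm B) {X N : F}
    (hX : B X X < 0) (hN : B N N < 0) (hXN : B X N < 0) :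
    ∃ κ > 0, ∀ v, B v v ≤ κ * ‖v‖ ^ 2 → B X v ≤ κ * ‖v‖ → κ * ‖v‖ ≤ -B N v := by
  -- By `neg_of_causal` the three quantities are never all nonpositive on the unit sphere, so
  -- compactness bounds their maximum below by some `m > 0`. With `κ = m / 2` the two hypotheses
  -- exclude the first two alternatives.
  let f : F → ℝ := fun v ↦ max (B v v) (max (B X v) (-B N v))
  have hf : Continuous f := by fun_prop
  have hpos : ∀ v ∈ Metric.sphere (0 : F) 1, 0 < f v := by
    intro v hv
    have hv0 : v ≠ 0 := by
      rintro rfl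
      simp at hv
    by_contra! hle
    simp only [f, max_le_iff] at hle
    linarith [hB.neg_of_causal hX hN hXN hv0 hle.1 hle.2.1]
  have : ProperSpace F := FiniteDimensional.proper ℝ F
  obtain ⟨m, hm, hmf⟩ : ∃ m > 0, ∀ v ∈ Metric.sphere (0 : F) 1, m ≤ f v := by
    rcases (Metric.sphere (0 : F) 1).eq_empty_or_nonempty with he | hne
    · exact ⟨1, one_pos, by simp [he]⟩
    · obtain ⟨v, hv, hmin⟩ := (isCompact_sphere (0 : F) 1).exists_isMinOn hne hf.continuousOn
      exact ⟨f v, hpos v hv, fun w hw ↦ hmin hw⟩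
  refine ⟨m / 2, by positivity, fun v h1 h2 ↦ ?_⟩
  rcases eq_or_ne v 0 with rfl | hv
  · simp
  have hn : 0 < ‖v‖ := norm_pos_iff.2 hv
  have hw := hmf (‖v‖⁻¹ • v) (by simp [norm_smul, hn.ne'])
  simp only [f, map_smul, FunLike.coe_smul, Pi.smul_apply, smul_eq_mul, le_max_iff] at hw
  rcases hw with hw | hw | hw
  · have : m * ‖v‖ ^ 2 ≤ B v v := by
      calc m * ‖v‖ ^ 2 ≤ (‖v‖⁻¹ * (‖v‖⁻¹ * B v v)) * ‖v‖ ^ 2 := by gcongr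
        _ = B v v := by field_simp
    nlinarith [mul_pos hm (pow_pos hn 2)]
  · have : m * ‖v‖ ≤ B X v := by
      calc m * ‖v‖ ≤ (‖v‖⁻¹ * B X v) * ‖v‖ := by gcongr
        _ = B X v := by field_simp
    nlinarith [mul_pos hm hn]
  · have : m * ‖v‖ ≤ -B N v := by
      calc m * ‖v‖ ≤ (-(‖v‖⁻¹ * B N v)) * ‖v‖ := by gcongr
        _ = -B N v := by field_simp
    nlinarith [mul_pos hm hn]

/-- Normalize `X` to a unit vector `T` and write `P = w - α T` with `w` orthogonal to `T`, so that
`B P P = Ω - α²` with `Ω = B w w ≥ 0`. The hypothesis is tested only on the vectors `T - μ w`. -/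
theorem IsLorentzForm.le_neg_one_of_forall (hB : IsLorentzForm B) {X P : F} (hX : B X X < 0)
    (hP : ∀ V, B V V < 0 → B X V < 0 → √(-B V V) ≤ B P V) : B P P ≤ -1 := by
  set r := √(-B X X) with hr
  have hr0 : 0 < r := Real.sqrt_pos.2 (by linarith)
  have hr2 : r ^ 2 = -B X X := Real.sq_sqrt (by linarith)
  set T := r⁻¹ • X with hT
  have hTT : B T T = -1 := by
    simp [hT]
    field_simp
    linarith
  have hXT : ∀ v, B X v = r * B T v := by
    intro v
    simp [hT]
    field_simp
  set α := B P T with hα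
  have hα1 : 1 ≤ α := by
    have := hP T (by rw [hTT]; norm_num) (by rw [hXT, hTT]; linarith)
    rwa [hTT, neg_neg, Real.sqrt_one] at this
  set w := P + α • T with hw
  have hTw : B T w = 0 := by simp [hw, hTT, hB.1 T P, ← hα]
  have hw0 : 0 ≤ B w w := hB.nonneg_of_orthogonal (by rw [hTT]; norm_num) hTw
  have hPw : B P w = B w w := by
    have : P = w - α • T := by simp [hw]
    rw [this]
    simp [hTw]
  have hPP : B P P = -α ^ 2 + B w w := by
    have : P = w - α • T := by simp [hw]
    rw [this]
    simp [hTw, hB.1 w T, hTT]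
    ring
  set Ω := B w w
  have key : ∀ μ : ℝ, μ ^ 2 * Ω < 1 → √(1 - μ ^ 2 * Ω) ≤ α - μ * Ω := by
    intro μ hμ
    have hVV : B (T - μ • w) (T - μ • w) = -(1 - μ ^ 2 * Ω) := by
      simp [hTw, hB.1 w T, hTT]
      ring
    have := hP (T - μ • w) (by rw [hVV]; linarith) (by rw [hXT]; simp [hTw, hTT, hr0])
    rw [hVV, neg_neg] at this
    simpa [hPw, ← hα] using this
  have hα0 : 0 < α := by linarith
  rcases lt_or_ge Ω (α ^ 2) with hlt | hge
  · have h1 := key α⁻¹ (by field_simp; exact hlt)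
    set D := α ^ 2 - Ω with hD
    have hD0 : 0 < D := by linarith
    have e1 : 1 - α⁻¹ ^ 2 * Ω = D / α ^ 2 := by rw [hD]; field_simp
    have e2 : α - α⁻¹ * Ω = D / α := by rw [hD]; field_simp
    rw [e1, e2, Real.sqrt_div hD0.le, Real.sqrt_sq hα0.le, div_le_div_iff_of_pos_right hα0] at h1
    have h2 : 1 ≤ √D := by
      have : √D * 1 ≤ √D * √D := by rw [Real.mul_self_sqrt hD0.le]; linarith
      exact le_of_mul_le_mul_left this (Real.sqrt_pos.2 hD0)
    linarith
  · exfalso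
    set κ := √Ω with hκ
    have hκ2 : κ ^ 2 = Ω := Real.sq_sqrt hw0
    have hκα : α ≤ κ := Real.le_sqrt_of_sq_le hge
    have hκ0 : 0 < κ := hα0.trans_le hκα
    -- If `P` were not timelike, a nearly null test vector would fail: the left side is of order
    -- `√δ`, the right side at most `δ α`.
    set δ := 1 / (2 * α ^ 2) with hδ
    have hδ0 : 0 < δ := by positivity
    have hδ1 : δ ≤ 1 / 2 := by
      rw [hδ, div_le_div_iff₀ (by positivity) (by norm_num)]
      nlinarith
    have e1 : ((1 - δ) / κ) ^ 2 * Ω = (1 - δ) ^ 2 := by rw [← hκ2]; field_simp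
    have e2 : (1 - δ) / κ * Ω = (1 - δ) * κ := by rw [← hκ2]; field_simp
    have h1 := key ((1 - δ) / κ) (by rw [e1]; nlinarith)
    rw [e1, e2] at h1
    have h2 : √(1 - (1 - δ) ^ 2) ≤ δ * α := by nlinarith
    have h3 := Real.sqrt_le_left (by positivity) |>.1 h2
    have h4 : δ * α ^ 2 = 1 / 2 := by rw [hδ]; field_simp
    nlinarith

end LorentzForm

/-! ### From the signature to the abstract Lorentzian form -/

section Signature

variable {n : ℕ} {M : Type*} [TopologicalSpace M]
  [ChartedSpace (EuclideanSpace ℝ (Fin (n + 1))) M] [IsManifold (𝓡 (n + 1)) ∞ M]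

/-- With `a`, `b` the timelike components of `T`, `v`, the vector `b T - a v` has none, so `b²
g(T,T) + a² g(v,v) ≥ 0`. Since `a ≠ 0`, having `g(v,v) ≤ 0` would force `b = 0` and then `v = 0`. -/
theorem LorentzianMetric.pos_of_orthogonal (g : LorentzianMetric n M) (x : M)
    {T v : TangentSpace (𝓡 (n + 1)) x} (hT : g.val x T T < 0) (h : g.val x T v = 0)
    (hv : v ≠ 0) : 0 < g.val x v v := by
  obtain ⟨e, he⟩ := g.signature x
  have hq : ∀ w, g.val x w w = ∑ i, (if i = 0 then -1 else 1) * (e.repr w i) ^ 2 := by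
    intro w
    conv_lhs => rw [← e.sum_repr w]
    simp only [map_sum, map_smul, FunLike.coe_sum, FunLike.coe_smul,
      Finset.sum_apply, Pi.smul_apply, he, smul_eq_mul, mul_ite, mul_zero, Finset.sum_ite_eq',
      Finset.mem_univ, if_true]
    refine Finset.sum_congr rfl fun i _ ↦ ?_
    split_ifs <;> ring
  have hq0 : ∀ w, e.repr w 0 = 0 → g.val x w w = ∑ i, (e.repr w i) ^ 2 := by
    intro w hw
    rw [hq]
    refine Finset.sum_congr rfl fun i _ ↦ ?_
    split_ifs with hi
    · rw [hi, hw]; ring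
    · ring
  have hT0 : e.repr T 0 ≠ 0 := by
    intro h0
    rw [hq0 T h0] at hT
    exact hT.not_ge (Finset.sum_nonneg fun i _ ↦ sq_nonneg _)
  set a := e.repr T 0
  set b := e.repr v 0
  have hw0 : e.repr (b • T - a • v) 0 = 0 := by
    simp [a, b, mul_comm]
  have hw : g.val x (b • T - a • v) (b • T - a • v) =
      b ^ 2 * g.val x T T + a ^ 2 * g.val x v v := by
    simp [h, g.symm x v T]
    ring
  have hnn : 0 ≤ g.val x (b • T - a • v) (b • T - a • v) := by
    rw [hq0 _ hw0]
    exact Finset.sum_nonneg fun i _ ↦ sq_nonneg _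
  have ha2 : 0 < a ^ 2 := by positivity
  by_contra! hle
  have hb : b = 0 := by
    by_contra hb
    have : 0 < b ^ 2 := by positivity
    nlinarith [mul_pos this (neg_pos.2 hT), mul_nonneg ha2.le (neg_nonneg.2 hle)]
  have hz : g.val x v v = 0 := by
    rw [hw, hb] at hnn
    nlinarith
  rw [hq0 v hb] at hz
  refine hv (e.ext_elem fun i ↦ ?_)
  have := (Finset.sum_eq_zero_iff_of_nonneg (fun i _ ↦ sq_nonneg _)).1 hz i (Finset.mem_univ i)
  simpa using this

theorem LorentzianMetric.isLorentzForm_form (g : LorentzianMetric n M) (x : M) :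
    IsLorentzForm (g.form x) :=
  ⟨g.symm x, fun _ _ hT h hv ↦ g.pos_of_orthogonal x hT h hv⟩

theorem SpaceTime.form_vec_vec_neg (S : SpaceTime n M) (x : M) :
    S.form x (S.vec x) (S.vec x) < 0 :=
  S.X_timelike x

end Signature

/-! ### Operations on piecewise C¹ curves -/

namespace SpaceTime

variable {n : ℕ} {M : Type*} [TopologicalSpace M]
  [ChartedSpace (EuclideanSpace ℝ (Fin (n + 1))) M] [IsManifold (𝓡 (n + 1)) ∞ M]
  {P Q : ∀ x : M, TangentSpace (𝓡 (n + 1)) x → Prop} {γ γ' : ℝ → M} {a b : ℝ}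

/-- All tangent spaces are definitionally the model space, so vectors at propositionally equal
points can be compared there. -/
theorem pred_of_eq {x y : M} {v : TangentSpace (𝓡 (n + 1)) x} {w : TangentSpace (𝓡 (n + 1)) y}
    (hxy : x = y) (hvw : (v : EuclideanSpace ℝ (Fin (n + 1))) = w) (h : P x v) : P y w := by
  subst hxy
  have : v = w := hvw
  exact this ▸ h

theorem IsPiecewiseC1With.mono (h : IsPiecewiseC1With P γ a b) (hPQ : ∀ x V, P x V → Q x V) :
    IsPiecewiseC1With Q γ a b := by
  obtain ⟨hab, hc, B, hB⟩ := h
  exact ⟨hab, hc, B, fun c d h1 h2 h3 h4 ↦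
    ⟨(hB c d h1 h2 h3 h4).1, fun t ht ↦ hPQ _ _ ((hB c d h1 h2 h3 h4).2 t ht)⟩⟩

theorem IsPiecewiseC1With.restrict (h : IsPiecewiseC1With P γ a b) {c d : ℝ} (hac : a ≤ c)
    (hcd : c < d) (hdb : d ≤ b) : IsPiecewiseC1With P γ c d := by
  obtain ⟨hab, hc, B, hB⟩ := h
  exact ⟨hcd, hc.mono (Icc_subset_Icc hac hdb), B, fun c' d' h1 h2 h3 h4 ↦
    hB c' d' (hac.trans h1) h2 (h3.trans hdb) h4⟩

theorem IsPiecewiseC1With.congr (h : IsPiecewiseC1With P γ a b) (he : EqOn γ' γ (Icc a b)) :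
    IsPiecewiseC1With P γ' a b := by
  obtain ⟨hab, hc, B, hB⟩ := h
  refine ⟨hab, hc.congr he, B, fun c d h1 h2 h3 h4 ↦ ?_⟩
  have hs : EqOn γ' γ (Icc c d) := he.mono (Icc_subset_Icc h1 h3)
  refine ⟨(hB c d h1 h2 h3 h4).1.congr hs, fun t ht ↦ ?_⟩
  refine pred_of_eq (hs ht).symm ?_ ((hB c d h1 h2 h3 h4).2 t ht)
  have := mfderivWithin_congr (I := 𝓘(ℝ, ℝ)) (I' := 𝓡 (n + 1)) hs (hs ht)
  exact (DFunLike.congr_fun this (1 : ℝ)).symm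

theorem IsPiecewiseC1With.trans {c : ℝ} (h₁ : IsPiecewiseC1With P γ a b)
    (h₂ : IsPiecewiseC1With P γ b c) : IsPiecewiseC1With P γ a c := by
  obtain ⟨hab, hc₁, B₁, hB₁⟩ := h₁
  obtain ⟨hbc, hc₂, B₂, hB₂⟩ := h₂
  refine ⟨hab.trans hbc, ?_, insert b (B₁ ∪ B₂), fun c' d' h1 h2 h3 h4 ↦ ?_⟩
  · rw [← Icc_union_Icc_eq_Icc hab.le hbc.le]
    exact hc₁.union_of_isClosed hc₂ isClosed_Icc isClosed_Icc
  · have hb := h4 b (by simp)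
    have h5 : ∀ t ∈ B₁, t ∉ Ioo c' d' := fun t ht ↦ h4 t (by simp [ht])
    have h6 : ∀ t ∈ B₂, t ∉ Ioo c' d' := fun t ht ↦ h4 t (by simp [ht])
    rcases le_or_gt d' b with hd | hd
    · exact hB₁ c' d' h1 h2 hd h5
    · have : b ≤ c' := by
        by_contra! hlt
        exact hb ⟨hlt, hd⟩
      exact hB₂ c' d' this h2 h3 h6

theorem IsPiecewiseC1With.trans' {c : ℝ} (h₁ : IsPiecewiseC1With P γ a b)
    (h₂ : IsPiecewiseC1With P γ' b c) (hb : γ b = γ' b) :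
    IsPiecewiseC1With P (fun t ↦ if t ≤ b then γ t else γ' t) a c := by
  refine (h₁.congr fun t ht ↦ if_pos ht.2).trans (h₂.congr fun t ht ↦ ?_)
  rcases ht.1.eq_or_lt with rfl | hlt
  · simp [hb]
  · exact if_neg (not_le.2 hlt)

theorem mfderivWithin_comp_affine {k m c d c' d' : ℝ} (hcd' : c' < d')
    (hmaps : MapsTo (fun t ↦ k * t + m) (Icc c' d') (Icc c d))
    (hγ : ContMDiffOn 𝓘(ℝ, ℝ) (𝓡 (n + 1)) 1 γ (Icc c d)) {t : ℝ} (ht : t ∈ Icc c' d') :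
    mfderivWithin 𝓘(ℝ, ℝ) (𝓡 (n + 1)) (fun t ↦ γ (k * t + m)) (Icc c' d') t (1 : ℝ) =
      k • mfderivWithin 𝓘(ℝ, ℝ) (𝓡 (n + 1)) γ (Icc c d) (k * t + m) (1 : ℝ) := by
  have h1 := (hγ.mdifferentiableOn one_ne_zero (k * t + m) (hmaps ht)).hasMFDerivWithinAt
  have h2 : HasDerivWithinAt (fun t ↦ k * t + m) k (Icc c' d') t := by
    simpa using (((hasDerivAt_id t).const_mul k).add_const m).hasDerivWithinAt
  have h3 := (hasMFDerivWithinAt_iff_hasFDerivWithinAt.2 h2.hasFDerivWithinAt)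
  have h4 := HasMFDerivWithinAt.comp (u := Icc c d) t h1 h3 hmaps
  have hu : UniqueMDiffWithinAt 𝓘(ℝ, ℝ) (Icc c' d') t :=
    (uniqueDiffOn_Icc hcd').uniqueMDiffOn t ht
  have h5 := DFunLike.congr_fun (h4.mfderivWithin hu) (1 : ℝ)
  refine h5.trans (Eq.trans ?_
    (map_smul (mfderivWithin 𝓘(ℝ, ℝ) (𝓡 (n + 1)) γ (Icc c d) (k * t + m)) k (1 : ℝ)))
  exact congrArg (mfderivWithin 𝓘(ℝ, ℝ) (𝓡 (n + 1)) γ (Icc c d) (k * t + m))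
    (show (ContinuousLinearMap.toSpanSingleton ℝ k) (1 : ℝ) = k • (1 : ℝ) by simp)

theorem contMDiffOn_comp_affine {k m c d c' d' : ℝ}
    (hmaps : MapsTo (fun t ↦ k * t + m) (Icc c' d') (Icc c d))
    (hγ : ContMDiffOn 𝓘(ℝ, ℝ) (𝓡 (n + 1)) 1 γ (Icc c d)) :
    ContMDiffOn 𝓘(ℝ, ℝ) (𝓡 (n + 1)) 1 (fun t ↦ γ (k * t + m)) (Icc c' d') := by
  have h : ContDiff ℝ 1 (fun t : ℝ ↦ k * t + m) := by fun_prop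
  exact hγ.comp h.contMDiff.contMDiffOn hmaps

theorem IsPiecewiseC1With.comp_affine {k m : ℝ} (hk : 0 < k)
    (h : IsPiecewiseC1With P γ (k * a + m) (k * b + m))
    (hPQ : ∀ x V, P x V → Q x (k • V)) :
    IsPiecewiseC1With Q (fun t ↦ γ (k * t + m)) a b := by
  obtain ⟨hab, hc, B, hB⟩ := h
  have hmaps : ∀ c d, MapsTo (fun t ↦ k * t + m) (Icc c d) (Icc (k * c + m) (k * d + m)) := by
    intro c d t ht
    constructor <;> dsimp only <;> nlinarith [ht.1, ht.2]
  refine ⟨by nlinarith, hc.comp (by fun_prop) (hmaps a b), B.image (fun t ↦ (t - m) / k),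
    fun c d h1 h2 h3 h4 ↦ ?_⟩
  obtain ⟨h5, h6⟩ := hB (k * c + m) (k * d + m) (by nlinarith) (by nlinarith) (by nlinarith) (by
    intro t ht hm
    refine h4 ((t - m) / k) (Finset.mem_image_of_mem _ ht) ⟨?_, ?_⟩
    · rw [lt_div_iff₀ hk]; linarith [hm.1]
    · rw [div_lt_iff₀ hk]; linarith [hm.2])
  refine ⟨contMDiffOn_comp_affine (hmaps c d) h5, fun t ht ↦ ?_⟩
  rw [mfderivWithin_comp_affine h2 (hmaps c d) h5 ht]
  exact hPQ _ _ (h6 _ (hmaps c d ht))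

theorem IsPiecewiseC1With.comp_neg (h : IsPiecewiseC1With P γ a b)
    (hPQ : ∀ x V, P x V → Q x (-V)) :
    IsPiecewiseC1With Q (fun t ↦ γ (-1 * t + 0)) (-b) (-a) := by
  obtain ⟨hab, hc, B, hB⟩ := h
  have hmaps : ∀ c d, MapsTo (fun t : ℝ ↦ -1 * t + 0) (Icc c d) (Icc (-d) (-c)) := by
    intro c d t ht
    constructor <;> dsimp only <;> linarith [ht.1, ht.2]
  refine ⟨by linarith, hc.comp (by fun_prop) (by simpa using hmaps (-b) (-a)), B.image (fun t ↦ -t),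
    fun c d h1 h2 h3 h4 ↦ ?_⟩
  obtain ⟨h5, h6⟩ := hB (-d) (-c) (by linarith) (by linarith) (by linarith) (by
    intro t ht hm
    exact h4 (-t) (Finset.mem_image_of_mem _ ht) ⟨by linarith [hm.2], by linarith [hm.1]⟩)
  refine ⟨contMDiffOn_comp_affine (hmaps c d) h5, fun t ht ↦ ?_⟩
  rw [mfderivWithin_comp_affine h2 (hmaps c d) h5 ht, neg_one_smul]
  exact hPQ _ _ (h6 _ (hmaps c d ht))

/-- Induction over the smooth pieces of a piecewise `C¹` curve. -/
theorem IsPiecewiseC1With.piece_induction {R : ℝ → ℝ → Prop} (h : IsPiecewiseC1With P γ a b)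
    (hadd : ∀ c d e, a ≤ c → c < d → d < e → e ≤ b → R c d → R d e → R c e)
    (hpiece : ∀ c d, a ≤ c → c < d → d ≤ b →
      ContMDiffOn 𝓘(ℝ, ℝ) (𝓡 (n + 1)) 1 γ (Icc c d) →
      (∀ t ∈ Icc c d, P (γ t) (mfderivWithin 𝓘(ℝ, ℝ) (𝓡 (n + 1)) γ (Icc c d) t (1 : ℝ))) →
      R c d) : R a b := by
  obtain ⟨hab, hc, B, hB⟩ := h
  -- The induction is on a finite set required only to contain the break points interior to the
  -- current subinterval, so it can shrink when the interval is cut.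
  have key : ∀ B' : Finset ℝ, ∀ c d, a ≤ c → c < d → d ≤ b →
      (∀ t ∈ B, t ∈ Ioo c d → t ∈ B') → R c d := by
    intro B'
    induction B' using Finset.induction_on with
    | empty =>
      intro c d h1 h2 h3 h4
      obtain ⟨h5, h6⟩ := hB c d h1 h2 h3 fun t ht hm ↦ by simpa using h4 t ht hm
      exact hpiece c d h1 h2 h3 h5 h6
    | insert s B' _ ih =>
      intro c d h1 h2 h3 h4
      by_cases hs : s ∈ Ioo c d
      · refine hadd c s d h1 hs.1 hs.2 h3 (ih c s h1 hs.1 (hs.2.le.trans h3) ?_)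
          (ih s d (h1.trans hs.1.le) hs.2 h3 ?_)
        · intro t ht hm
          have := h4 t ht ⟨hm.1, hm.2.trans hs.2⟩
          exact (Finset.mem_insert.1 this).resolve_left hm.2.ne
        · intro t ht hm
          have := h4 t ht ⟨hs.1.trans hm.1, hm.2⟩
          exact (Finset.mem_insert.1 this).resolve_left hm.1.ne'
      · refine ih c d h1 h2 h3 fun t ht hm ↦ ?_
        refine (Finset.mem_insert.1 (h4 t ht hm)).resolve_left ?_
        rintro rfl
        exact hs hm
  exact key B a b le_rfl hab le_rfl fun t ht _ ↦ ht

/-! ### Time reversal -/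

/-- The space-time with the opposite time orientation. -/
noncomputable def rev (S : SpaceTime n M) : SpaceTime n M where
  toLorentzianMetric := S.toLorentzianMetric
  X := fun x ↦ -S.X x
  X_continuous := by
    have h1 : ContMDiff (𝓡 (n + 1)) ((𝓡 (n + 1)).prod 𝓘(ℝ, EuclideanSpace ℝ (Fin (n + 1)))) 0
        (fun x ↦ (TotalSpace.mk' (EuclideanSpace ℝ (Fin (n + 1))) x (S.X x))) :=
      contMDiff_zero_iff.2 S.X_continuous
    exact h1.neg_section.continuous
  X_timelike := fun x ↦ by simpa using S.X_timelike x

theorem isFutureDirected_rev_neg (S : SpaceTime n M) {x : M} {V : TangentSpace (𝓡 (n + 1)) x}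
    (h : S.IsFutureDirected V) : S.rev.IsFutureDirected (-V) := by
  obtain ⟨⟨h1, h2⟩, h3⟩ := h
  refine ⟨⟨neg_ne_zero.2 h1, ?_⟩, ?_⟩
  · change S.val x (-V) (-V) ≤ 0
    simpa using h2
  · change S.val x (-S.X x) (-V) < 0
    simpa using h3

theorem rev_rev (S : SpaceTime n M) : S.rev.rev = S := by
  unfold rev
  simp

theorem IsTimelikeCurve.comp_neg {S : SpaceTime n M} (h : S.IsTimelikeCurve γ a b) :
    S.rev.IsTimelikeCurve (fun t ↦ γ (-1 * t + 0)) (-b) (-a) :=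
  IsPiecewiseC1With.comp_neg h fun x V hV ↦
    ⟨by change S.val x (-V) (-V) < 0; simpa using (show S.val x V V < 0 from hV.1), S.isFutureDirected_rev_neg hV.2⟩

theorem Chron.rev {S : SpaceTime n M} {p q : M} (h : S.Chron p q) : S.rev.Chron q p := by
  obtain ⟨γ, a, b, h, rfl, rfl⟩ := h
  exact ⟨_, _, _, h.comp_neg, by simp, by simp⟩

theorem chron_rev_iff {S : SpaceTime n M} {p q : M} : S.rev.Chron p q ↔ S.Chron q p :=
  ⟨fun h ↦ by simpa only [rev_rev] using h.rev, fun h ↦ h.rev⟩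

/-! ### Joining points -/

/-- `p < q`: there is a future directed causal curve from `p` to `q`. -/
def CausLt (S : SpaceTime n M) (p q : M) : Prop :=
  ∃ (γ : ℝ → M) (a b : ℝ), S.IsCausalCurve γ a b ∧ γ a = p ∧ γ b = q

theorem IsTimelikeCurve.isCausalCurve {S : SpaceTime n M} (h : S.IsTimelikeCurve γ a b) :
    S.IsCausalCurve γ a b :=
  IsPiecewiseC1With.mono h fun _ _ hV ↦ hV.2

theorem Chron.causLt {S : SpaceTime n M} {p q : M} (h : S.Chron p q) : S.CausLt p q := by
  obtain ⟨γ, a, b, h, h1, h2⟩ := h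
  exact ⟨γ, a, b, h.isCausalCurve, h1, h2⟩

/-- Normalizing the parameter interval lets infinitely many curves be glued at integer times. -/
theorem exists_unit_interval (hP : ∀ x V, ∀ k : ℝ, 0 < k → P x V → P x (k • V))
    (h : IsPiecewiseC1With P γ a b) (s : ℝ) :
    ∃ σ : ℝ → M, IsPiecewiseC1With P σ s (s + 1) ∧ σ s = γ a ∧ σ (s + 1) = γ b := by
  have hab := h.1
  refine ⟨fun t ↦ γ ((b - a) * t + (a - (b - a) * s)), ?_, ?_, ?_⟩
  · refine IsPiecewiseC1With.comp_affine (sub_pos.2 hab) ?_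
      (fun x V hV ↦ hP x V _ (sub_pos.2 hab) hV)
    convert h using 1 <;> ring
  · dsimp only; congr 1; ring
  · dsimp only; congr 1; ring

theorem isFutureDirected_smul (S : SpaceTime n M) {x : M} {V : TangentSpace (𝓡 (n + 1)) x}
    {k : ℝ} (hk : 0 < k) (h : S.IsFutureDirected V) : S.IsFutureDirected (k • V) := by
  obtain ⟨⟨h1, h2⟩, h3⟩ := h
  refine ⟨⟨smul_ne_zero hk.ne' h1, ?_⟩, ?_⟩
  · simp only [map_smul, FunLike.coe_smul, Pi.smul_apply, smul_eq_mul]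
    nlinarith [mul_nonneg hk.le (mul_nonneg hk.le (neg_nonneg.2 h2))]
  · simp only [map_smul, smul_eq_mul]
    nlinarith

theorem isTimelike_smul (S : SpaceTime n M) {x : M} {V : TangentSpace (𝓡 (n + 1)) x}
    {k : ℝ} (hk : 0 < k) (h : S.IsTimelike V) : S.IsTimelike (k • V) := by
  unfold IsTimelike at *
  simp only [map_smul, FunLike.coe_smul, Pi.smul_apply, smul_eq_mul]
  nlinarith [mul_pos hk (mul_pos hk (neg_pos.2 h))]

theorem exists_trans {p q r : M} (hP : ∀ x V, ∀ k : ℝ, 0 < k → P x V → P x (k • V))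
    (h₁ : ∃ (γ : ℝ → M) (a b : ℝ), IsPiecewiseC1With P γ a b ∧ γ a = p ∧ γ b = q)
    (h₂ : ∃ (γ : ℝ → M) (a b : ℝ), IsPiecewiseC1With P γ a b ∧ γ a = q ∧ γ b = r) :
    ∃ (γ : ℝ → M) (a b : ℝ), IsPiecewiseC1With P γ a b ∧ γ a = p ∧ γ b = r := by
  obtain ⟨γ₁, a, b, h₁, rfl, rfl⟩ := h₁
  obtain ⟨γ₂, c, d, h₂, he, rfl⟩ := h₂
  obtain ⟨σ, hσ, e1, e2⟩ := exists_unit_interval hP h₂ b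
  refine ⟨_, _, _, h₁.trans' hσ (by rw [e1, he]), ?_, ?_⟩
  · simp [h₁.1.le]
  · simp [e2]

theorem Chron.trans {S : SpaceTime n M} {p q r : M} (h₁ : S.Chron p q) (h₂ : S.Chron q r) :
    S.Chron p r :=
  exists_trans (fun _ _ _ hk hV ↦ ⟨S.isTimelike_smul hk hV.1, S.isFutureDirected_smul hk hV.2⟩)
    h₁ h₂

theorem CausLt.trans {S : SpaceTime n M} {p q r : M} (h₁ : S.CausLt p q) (h₂ : S.CausLt q r) :
    S.CausLt p r :=
  exists_trans (fun _ _ _ hk hV ↦ S.isFutureDirected_smul hk hV) h₁ h₂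

theorem CausLt.trans_caus {S : SpaceTime n M} {p q r : M} (h₁ : S.CausLt p q)
    (h₂ : S.Caus q r) : S.CausLt p r := by
  rcases h₂ with rfl | h₂
  · exact h₁
  · exact h₁.trans h₂

end SpaceTime

namespace SpaceTime

variable {n : ℕ} {M : Type*} [TopologicalSpace M]
  [ChartedSpace (EuclideanSpace ℝ (Fin (n + 1))) M] [IsManifold (𝓡 (n + 1)) ∞ M]
  {P Q : ∀ x : M, TangentSpace (𝓡 (n + 1)) x → Prop} {γ γ' : ℝ → M} {a b : ℝ}

/-! ### Length of curves -/

/-- The Lorentzian norm `√(-g(γ', γ'))` of the velocity of a curve. -/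
noncomputable def speed (S : SpaceTime n M) (γ : ℝ → M) (t : ℝ) : ℝ :=
  Real.sqrt (-S.val (γ t)
    (mfderiv 𝓘(ℝ, ℝ) (𝓡 (n + 1)) γ t (1 : ℝ)) (mfderiv 𝓘(ℝ, ℝ) (𝓡 (n + 1)) γ t (1 : ℝ)))

/-- Length uses the unrestricted derivative, while the `C¹` condition is one-sided at the ends of
each piece. They agree in the interior, which is all that the integral sees. -/
theorem speed_eq_within (S : SpaceTime n M) {t : ℝ} (ht : t ∈ Ioo a b) :
    S.speed γ t = Real.sqrt (-S.val (γ t)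
      (mfderivWithin 𝓘(ℝ, ℝ) (𝓡 (n + 1)) γ (Icc a b) t (1 : ℝ))
      (mfderivWithin 𝓘(ℝ, ℝ) (𝓡 (n + 1)) γ (Icc a b) t (1 : ℝ))) := by
  rw [mfderivWithin_of_mem_nhds (Icc_mem_nhds ht.1 ht.2)]
  rfl

theorem speed_congr (S : SpaceTime n M) {t : ℝ} (h : γ' =ᶠ[𝓝 t] γ) :
    S.speed γ' t = S.speed γ t := by
  have h1 := h.mfderiv_eq (I := 𝓘(ℝ, ℝ)) (I' := 𝓡 (n + 1))
  have h2 : γ' t = γ t := h.eq_of_nhds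
  have h3 := DFunLike.congr_fun h1 (1 : ℝ)
  have := pred_of_eq (P := fun x V ↦ Real.sqrt (-S.val x V V) = S.speed γ t) h2.symm h3.symm rfl
  exact this

theorem length_congr (S : SpaceTime n M) (hab : a ≤ b) (h : EqOn γ' γ (Icc a b)) :
    S.length γ' a b = S.length γ a b := by
  refine intervalIntegral.integral_congr_Ioo_of_le hab fun t ht ↦ ?_
  exact S.speed_congr (h.eventuallyEq_of_mem (Icc_mem_nhds ht.1 ht.2))

theorem IsPiecewiseC1With.intervalIntegrable_speed (S : SpaceTime n M)
    (h : IsPiecewiseC1With P γ a b) :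
    IntervalIntegrable (S.speed γ) MeasureTheory.volume a b := by
  refine h.piece_induction
    (R := fun c d ↦ IntervalIntegrable (S.speed γ) MeasureTheory.volume c d)
    (fun c d e _ _ _ _ h1 h2 ↦ h1.trans h2) ?_
  intro c d _ hcd _ h1 _
  have h2 := (continuousOn_val_mfderivWithin S.toLorentzianMetric hcd h1).neg.sqrt
  have h3 := h2.intervalIntegrable_of_Icc hcd.le (μ := MeasureTheory.volume)
  refine h3.congr_uIoo fun t ht ↦ ?_
  rw [uIoo_of_le hcd.le] at ht
  exact (S.speed_eq_within ht).symm

theorem IsPiecewiseC1With.length_add (S : SpaceTime n M) (h : IsPiecewiseC1With P γ a b)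
    {c : ℝ} (hac : a ≤ c) (hcb : c ≤ b) :
    S.length γ a c + S.length γ c b = S.length γ a b := by
  have hi := h.intervalIntegrable_speed S
  have hab : a ≤ b := hac.trans hcb
  refine intervalIntegral.integral_add_adjacent_intervals (hi.mono_set ?_) (hi.mono_set ?_)
  · rw [uIcc_of_le hac, uIcc_of_le hab]
    exact Icc_subset_Icc le_rfl hcb
  · rw [uIcc_of_le hcb, uIcc_of_le hab]
    exact Icc_subset_Icc hac le_rfl

/-- Length is bounded by the increment of a linear function of the coordinates which dominates
the Lorentzian norm on future directed vectors. -/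
theorem IsPiecewiseC1With.length_le (S : SpaceTime n M) {c : M}
    (h : IsPiecewiseC1With P γ a b)
    (hsrc : ∀ t ∈ Icc a b, γ t ∈ (chartAt (EuclideanSpace ℝ (Fin (n + 1))) c).source)
    (l : EuclideanSpace ℝ (Fin (n + 1)) →L[ℝ] ℝ)
    (hl : ∀ t ∈ Icc a b, ∀ V : TangentSpace (𝓡 (n + 1)) (γ t), P (γ t) V →
      Real.sqrt (-S.val (γ t) V V) ≤ l (chartCoord c (γ t) V)) :
    S.length γ a b ≤ l (extChartAt (𝓡 (n + 1)) c (γ b)) - l (extChartAt (𝓡 (n + 1)) c (γ a)) := by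
  refine h.piece_induction
    (R := fun s t ↦ S.length γ s t ≤ l (extChartAt (𝓡 (n + 1)) c (γ t)) -
      l (extChartAt (𝓡 (n + 1)) c (γ s))) ?_ ?_
  · intro s t u hs hst htu hu h1 h2
    have := (h.restrict hs (hst.trans htu) hu).length_add S hst.le htu.le
    linarith
  · intro s t hs hst ht hC hP
    have hsub : Icc s t ⊆ Icc a b := Icc_subset_Icc hs ht
    have hder : ∀ τ ∈ Icc s t, HasDerivWithinAt (fun τ ↦ l (extChartAt (𝓡 (n + 1)) c (γ τ)))
        (l (chartCoord c (γ τ) (mfderivWithin 𝓘(ℝ, ℝ) (𝓡 (n + 1)) γ (Icc s t) τ (1 : ℝ))))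
        (Icc s t) τ := fun τ hτ ↦
      l.hasFDerivAt.comp_hasDerivWithinAt τ (hasDerivWithinAt_extChartAt_comp
        (hC.mdifferentiableOn one_ne_zero τ hτ) (hsrc τ (hsub hτ)))
    refine intervalIntegral.integral_le_sub_of_hasDeriv_right_of_le hst.le
      (g := fun τ ↦ l (extChartAt (𝓡 (n + 1)) c (γ τ)))
      (fun τ hτ ↦ (hder τ hτ).continuousWithinAt)
      (fun τ hτ ↦ ((hder τ (Ioo_subset_Icc_self hτ)).hasDerivAt
        (Icc_mem_nhds hτ.1 hτ.2)).hasDerivWithinAt) ?_ ?_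
    · have := (h.restrict hs hst ht).intervalIntegrable_speed S
      rwa [intervalIntegrable_iff_integrableOn_Icc_of_le hst.le] at this
    · intro τ hτ
      have hτ' := Ioo_subset_Icc_self hτ
      have h1 := hl τ (hsub hτ') _ (hP τ hτ')
      rw [← S.speed_eq_within hτ] at h1
      exact h1

theorem length_nonneg (S : SpaceTime n M) (hab : a ≤ b) : 0 ≤ S.length γ a b :=
  intervalIntegral.integral_nonneg hab fun _ _ ↦ Real.sqrt_nonneg _

/-! ### Adapted coordinate balls -/

/-- The coordinate ball of radius `r` in the chart at `c`. -/
def chartBall (c : M) (r : ℝ) : Set M :=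
  (extChartAt (𝓡 (n + 1)) c).source ∩
    extChartAt (𝓡 (n + 1)) c ⁻¹' Metric.ball (extChartAt (𝓡 (n + 1)) c c) r

theorem isOpen_chartBall (c : M) (r : ℝ) : IsOpen (chartBall (n := n) c r) :=
  isOpen_extChartAt_preimage' c Metric.isOpen_ball

theorem mem_chartBall_self (c : M) {r : ℝ} (hr : 0 < r) : c ∈ chartBall (n := n) c r :=
  ⟨mem_extChartAt_source c, Metric.mem_ball_self hr⟩

/-- On the coordinate ball of radius `r` the metric and the time orientation differ from those at
the centre by at most `ε`. -/
structure IsAdapted (S : SpaceTime n M) (c : M) (ε r : ℝ) : Prop where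
  pos : 0 < r
  subset_target : Metric.ball (extChartAt (𝓡 (n + 1)) c c) r ⊆ (extChartAt (𝓡 (n + 1)) c).target
  val_sub_le : ∀ p ∈ chartBall (n := n) c r, ∀ V : TangentSpace (𝓡 (n + 1)) p,
    |S.val p V V - S.form c (chartCoord c p V) (chartCoord c p V)| ≤ ε * ‖chartCoord c p V‖ ^ 2
  val_X_sub_le : ∀ p ∈ chartBall (n := n) c r, ∀ V : TangentSpace (𝓡 (n + 1)) p,
    |S.val p (S.X p) V - S.form c (S.vec c) (chartCoord c p V)| ≤ ε * ‖chartCoord c p V‖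

theorem exists_chartBall_subset (c : M) {W : Set M} (hW : W ∈ 𝓝 c) :
    ∃ r > 0, Metric.ball (extChartAt (𝓡 (n + 1)) c c) r ⊆ (extChartAt (𝓡 (n + 1)) c).target ∧
      chartBall (n := n) c r ⊆ W := by
  have h1 := extChartAt_target_mem_nhds (I := 𝓡 (n + 1)) c
  have h2 : (extChartAt (𝓡 (n + 1)) c).symm ⁻¹' W ∈ 𝓝 (extChartAt (𝓡 (n + 1)) c c) :=
    (continuousAt_extChartAt_symm (I := 𝓡 (n + 1)) c).preimage_mem_nhds (by
      rwa [extChartAt_to_inv])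
  obtain ⟨r, hr, hsub⟩ := Metric.mem_nhds_iff.1 (inter_mem h1 h2)
  refine ⟨r, hr, fun e he ↦ (hsub he).1, fun p hp ↦ ?_⟩
  have := (hsub hp.2).2
  rwa [mem_preimage, (extChartAt (𝓡 (n + 1)) c).left_inv hp.1] at this

theorem exists_isAdapted (S : SpaceTime n M) (c : M) {ε : ℝ} (hε : 0 < ε) {W : Set M}
    (hW : W ∈ 𝓝 c) : ∃ r, S.IsAdapted c ε r ∧ chartBall (n := n) c r ⊆ W := by
  obtain ⟨r, hr, hsub, h⟩ := exists_chartBall_subset (n := n) c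
    (inter_mem hW (S.eventually_val_sub_le c hε))
  exact ⟨r, ⟨hr, hsub, fun p hp V ↦ ((h hp).2 V).1, fun p hp V ↦ ((h hp).2 V).2⟩,
    fun p hp ↦ (h hp).1⟩

/-- Vectors which are future directed timelike, with a margin of `ε`. -/
def cone (S : SpaceTime n M) (c : M) (ε : ℝ) : Set (EuclideanSpace ℝ (Fin (n + 1))) :=
  {w | S.form c w w < -(ε * ‖w‖ ^ 2) ∧ S.form c (S.vec c) w < -(ε * ‖w‖)}

theorem isOpen_cone (S : SpaceTime n M) (c : M) (ε : ℝ) : IsOpen (S.cone c ε) := by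
  have h1 : IsOpen {w | S.form c w w < -(ε * ‖w‖ ^ 2)} := isOpen_lt (by fun_prop) (by fun_prop)
  have h2 : IsOpen {w | S.form c (S.vec c) w < -(ε * ‖w‖)} :=
    isOpen_lt (by fun_prop) (by fun_prop)
  exact h1.inter h2

theorem smul_mem_cone {S : SpaceTime n M} {c : M} {ε k : ℝ} (hk : 0 < k)
    {w : EuclideanSpace ℝ (Fin (n + 1))} (hw : w ∈ S.cone c ε) : k • w ∈ S.cone c ε := by
  obtain ⟨h1, h2⟩ := hw
  constructor
  · simp only [map_smul, FunLike.coe_smul, Pi.smul_apply, smul_eq_mul, norm_smul,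
      Real.norm_eq_abs, abs_of_pos hk]
    nlinarith [mul_pos hk hk]
  · simp only [map_smul, smul_eq_mul, norm_smul, Real.norm_eq_abs, abs_of_pos hk]
    nlinarith

theorem exists_mem_cone (S : SpaceTime n M) (c : M) {w : EuclideanSpace ℝ (Fin (n + 1))}
    (h1 : S.form c w w < 0) (h2 : S.form c (S.vec c) w < 0) : ∀ᶠ ε in 𝓝[>] (0 : ℝ), w ∈ S.cone c ε := by
  have e1 : ∀ᶠ ε in 𝓝 (0 : ℝ), S.form c w w < -(ε * ‖w‖ ^ 2) :=
    (continuous_const.continuousAt).eventually_lt (by fun_prop) (by simpa using h1)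
  have e2 : ∀ᶠ ε in 𝓝 (0 : ℝ), S.form c (S.vec c) w < -(ε * ‖w‖) :=
    (continuous_const.continuousAt).eventually_lt (by fun_prop) (by simpa using h2)
  exact nhdsWithin_le_nhds (e1.and e2)

/-- The margin `ε` of the cone absorbs the error `ε` of the metric and of the time orientation. -/
theorem IsAdapted.timelike {S : SpaceTime n M} {c p : M} {ε r : ℝ} (h : S.IsAdapted c ε r)
    (hp : p ∈ chartBall (n := n) c r) {V : TangentSpace (𝓡 (n + 1)) p}
    (hV : chartCoord c p V ∈ S.cone c ε) : S.IsTimelike V ∧ S.IsFutureDirected V := by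
  have h1 := (abs_le.1 (h.val_sub_le p hp V)).2
  have h2 := (abs_le.1 (h.val_X_sub_le p hp V)).2
  have h3 : S.val p V V < 0 := by linarith [hV.1]
  refine ⟨h3, ⟨?_, h3.le⟩, by linarith [hV.2]⟩
  rintro rfl
  simp at h3

/-! ### Coordinate straight segments as timelike curves -/

section Segment

variable {S : SpaceTime n M} {c : M} {ε r : ℝ} {e w : EuclideanSpace ℝ (Fin (n + 1))} {s τ : ℝ}

/-- The coordinate straight line through `e` at time `s` with velocity `w`. -/
noncomputable def chartLine (c : M) (e w : EuclideanSpace ℝ (Fin (n + 1))) (s : ℝ) : ℝ → M :=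
  fun t ↦ (extChartAt (𝓡 (n + 1)) c).symm (e + (t - s) • w)

theorem line_mem_ball {x : EuclideanSpace ℝ (Fin (n + 1))} (hτ : 0 < τ) (he : e ∈ Metric.ball x r)
    (he' : e + τ • w ∈ Metric.ball x r) {t : ℝ} (ht : t ∈ Icc s (s + τ)) :
    e + (t - s) • w ∈ Metric.ball x r := by
  have h := (convex_ball x r).add_smul_sub_mem he he' (t := (t - s) / τ)
    ⟨div_nonneg (by linarith [ht.1]) hτ.le, (div_le_one hτ).2 (by linarith [ht.2])⟩
  rwa [add_sub_cancel_left, smul_smul, div_mul_cancel₀ _ hτ.ne'] at h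

theorem IsAdapted.symm_mem_chartBall (h : S.IsAdapted c ε r)
    (he : e ∈ Metric.ball (extChartAt (𝓡 (n + 1)) c c) r) :
    (extChartAt (𝓡 (n + 1)) c).symm e ∈ chartBall (n := n) c r := by
  have := h.subset_target he
  exact ⟨(extChartAt (𝓡 (n + 1)) c).map_target this, by
    rwa [mem_preimage, (extChartAt (𝓡 (n + 1)) c).right_inv this]⟩

theorem IsAdapted.contMDiffOn_chartLine (h : S.IsAdapted c ε r) (hτ : 0 < τ)
    (he : e ∈ Metric.ball (extChartAt (𝓡 (n + 1)) c c) r)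
    (he' : e + τ • w ∈ Metric.ball (extChartAt (𝓡 (n + 1)) c c) r) :
    ContMDiffOn 𝓘(ℝ, ℝ) (𝓡 (n + 1)) 1 (chartLine c e w s) (Icc s (s + τ)) := by
  have h1 : ContDiff ℝ 1 (fun t : ℝ ↦ e + (t - s) • w) := by fun_prop
  exact (contMDiffOn_extChartAt_symm (I := 𝓡 (n + 1)) (n := 1) c).comp
    h1.contMDiff.contMDiffOn (fun t ht ↦ h.subset_target (line_mem_ball hτ he he' ht))

theorem IsAdapted.chartCoord_chartLine (h : S.IsAdapted c ε r) (hτ : 0 < τ)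
    (he : e ∈ Metric.ball (extChartAt (𝓡 (n + 1)) c c) r)
    (he' : e + τ • w ∈ Metric.ball (extChartAt (𝓡 (n + 1)) c c) r) {s' t' t : ℝ}
    (hs' : s ≤ s') (hst : s' < t') (ht' : t' ≤ s + τ) (ht : t ∈ Icc s' t') :
    chartCoord c (chartLine c e w s t) (mfderivWithin 𝓘(ℝ, ℝ) (𝓡 (n + 1)) (chartLine c e w s)
      (Icc s' t') t (1 : ℝ)) = w := by
  have h1 : HasDerivAt (fun t : ℝ ↦ e + (t - s) • w) ((1 : ℝ) • w) t :=
    (((hasDerivAt_id t).sub_const s).smul_const w).const_add e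
  rw [one_smul] at h1
  have h2 : ∀ u ∈ Icc s' t', e + (u - s) • w ∈ (extChartAt (𝓡 (n + 1)) c).target := fun u hu ↦
    h.subset_target (line_mem_ball hτ he he' ⟨hs'.trans hu.1, hu.2.trans ht'⟩)
  exact chartCoord_mfderivWithin_symm_comp (η := fun t ↦ e + (t - s) • w)
    (uniqueDiffOn_Icc hst t ht) h1.hasDerivWithinAt ht h2

theorem IsAdapted.isTimelikeCurve_chartLine (h : S.IsAdapted c ε r) (hτ : 0 < τ)
    (he : e ∈ Metric.ball (extChartAt (𝓡 (n + 1)) c c) r)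
    (he' : e + τ • w ∈ Metric.ball (extChartAt (𝓡 (n + 1)) c c) r) (hw : w ∈ S.cone c ε) :
    S.IsTimelikeCurve (chartLine c e w s) s (s + τ) := by
  have h1 := h.contMDiffOn_chartLine (s := s) hτ he he'
  refine ⟨by linarith, h1.continuousOn, ∅, fun s' t' hs' hst ht' _ ↦
    ⟨h1.mono (Icc_subset_Icc hs' ht'), fun t ht ↦ ?_⟩⟩
  refine h.timelike (h.symm_mem_chartBall
    (line_mem_ball hτ he he' ⟨hs'.trans ht.1, ht.2.trans ht'⟩)) ?_
  have := h.chartCoord_chartLine hτ he he' hs' hst ht' ht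
  exact this.symm ▸ hw

theorem IsAdapted.le_length_chartLine (h : S.IsAdapted c ε r) (hτ : 0 < τ)
    (he : e ∈ Metric.ball (extChartAt (𝓡 (n + 1)) c c) r)
    (he' : e + τ • w ∈ Metric.ball (extChartAt (𝓡 (n + 1)) c c) r) (hw : w ∈ S.cone c ε) :
    τ * √(-S.form c w w - ε * ‖w‖ ^ 2) ≤ S.length (chartLine c e w s) s (s + τ) := by
  have h1 : ∫ _ in s..(s + τ), √(-S.form c w w - ε * ‖w‖ ^ 2) =
      τ * √(-S.form c w w - ε * ‖w‖ ^ 2) := by simp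
  rw [← h1]
  refine intervalIntegral.integral_mono_on_of_le_Ioo (by linarith) (by simp)
    (IsPiecewiseC1With.intervalIntegrable_speed S (h.isTimelikeCurve_chartLine hτ he he' hw)) ?_
  intro t ht
  have ht' := Ioo_subset_Icc_self ht
  change _ ≤ S.speed (chartLine c e w s) t
  rw [S.speed_eq_within ht]
  refine Real.sqrt_le_sqrt ?_
  have h2 := h.val_sub_le (chartLine c e w s t)
    (h.symm_mem_chartBall (line_mem_ball hτ he he' ht'))
    (mfderivWithin 𝓘(ℝ, ℝ) (𝓡 (n + 1)) (chartLine c e w s) (Icc s (s + τ)) t (1 : ℝ))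
  rw [h.chartCoord_chartLine hτ he he' le_rfl (by linarith) le_rfl ht'] at h2
  linarith [(abs_le.1 h2).2]

theorem IsAdapted.chron (h : S.IsAdapted c ε r) {e₀ e₁ : EuclideanSpace ℝ (Fin (n + 1))}
    (h₀ : e₀ ∈ Metric.ball (extChartAt (𝓡 (n + 1)) c c) r)
    (h₁ : e₁ ∈ Metric.ball (extChartAt (𝓡 (n + 1)) c c) r) (hw : e₁ - e₀ ∈ S.cone c ε) :
    S.Chron ((extChartAt (𝓡 (n + 1)) c).symm e₀) ((extChartAt (𝓡 (n + 1)) c).symm e₁) :=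
  ⟨_, _, _, h.isTimelikeCurve_chartLine (s := 0) one_pos h₀ (by simpa using h₁) hw,
    by simp [chartLine], by simp [chartLine]⟩

end Segment

end SpaceTime

namespace SpaceTime

variable {n : ℕ} {M : Type*} [TopologicalSpace M]
  [ChartedSpace (EuclideanSpace ℝ (Fin (n + 1))) M] [IsManifold (𝓡 (n + 1)) ∞ M]
  {P Q : ∀ x : M, TangentSpace (𝓡 (n + 1)) x → Prop} {γ γ' : ℝ → M} {a b : ℝ}

/-! ### Openness of chronological futures and pasts -/

theorem IsPiecewiseC1With.exists_last_piece (h : IsPiecewiseC1With P γ a b) :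
    ∃ c, a ≤ c ∧ c < b ∧ ContMDiffOn 𝓘(ℝ, ℝ) (𝓡 (n + 1)) 1 γ (Icc c b) ∧
      ∀ t ∈ Icc c b, P (γ t) (mfderivWithin 𝓘(ℝ, ℝ) (𝓡 (n + 1)) γ (Icc c b) t (1 : ℝ)) := by
  refine h.piece_induction (R := fun s b ↦ ∃ c, s ≤ c ∧ c < b ∧
      ContMDiffOn 𝓘(ℝ, ℝ) (𝓡 (n + 1)) 1 γ (Icc c b) ∧
      ∀ t ∈ Icc c b, P (γ t) (mfderivWithin 𝓘(ℝ, ℝ) (𝓡 (n + 1)) γ (Icc c b) t (1 : ℝ))) ?_ ?_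
  · rintro s t u - hst - - - ⟨c, h1, h2⟩
    exact ⟨c, hst.le.trans h1, h2⟩
  · intro s t _ hst _ h1 h2
    exact ⟨s, le_rfl, hst, h1, h2⟩

/-- The final velocity is timelike, so slightly before the end the coordinate difference to `q` lies
in the open cone. This persists for `q'` near `q`, and a straight segment to `q'` replaces the last
bit of the curve. -/
theorem isOpen_chronFuture (S : SpaceTime n M) (p : M) : IsOpen {q | S.Chron p q} := by
  rw [isOpen_iff_mem_nhds]
  rintro q ⟨γ, a, b, hγ, hpa, hqb⟩
  obtain ⟨s, has, hsb, hC, hP⟩ := IsPiecewiseC1With.exists_last_piece hγ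
  have hb : b ∈ Icc s b := right_mem_Icc.2 hsb.le
  have hqsrc : γ b ∈ (chartAt (EuclideanSpace ℝ (Fin (n + 1))) q).source := by
    rw [hqb]; exact mem_chart_source _ q
  set v := chartCoord q (γ b) (mfderivWithin 𝓘(ℝ, ℝ) (𝓡 (n + 1)) γ (Icc s b) b (1 : ℝ)) with hv
  have hder : HasDerivWithinAt (fun t ↦ extChartAt (𝓡 (n + 1)) q (γ t)) v (Icc s b) b :=
    hasDerivWithinAt_extChartAt_comp (hC.mdifferentiableOn one_ne_zero b hb) hqsrc
  have hPv : S.form q v v < 0 ∧ S.form q (S.vec q) v < 0 := by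
    have h1 := pred_of_eq
      (P := fun x V ↦ S.val x V V < 0 ∧ S.val x (S.X x) V < 0) (y := q) (w := v) hqb ?_
      ⟨(hP b hb).1, (hP b hb).2.2⟩
    · exact h1
    · rw [hv]
      have : ∀ (x : M) (_ : x = q) (V : TangentSpace (𝓡 (n + 1)) x),
          (V : EuclideanSpace ℝ (Fin (n + 1))) = chartCoord q x V := by
        rintro x rfl V
        exact (chartCoord_self x V).symm
      exact this _ hqb _
  obtain ⟨ε, hvε, hε⟩ := ((S.exists_mem_cone q hPv.1 hPv.2).and self_mem_nhdsWithin).exists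
  obtain ⟨r, hr, -⟩ := S.exists_isAdapted q hε univ_mem
  have hev1 := (hasDerivWithinAt_iff_tendsto_slope.1 hder).eventually
    ((S.isOpen_cone q ε).mem_nhds hvε)
  have hev2 : ∀ᶠ t in 𝓝[Icc s b \ {b}] b, γ t ∈ chartBall (n := n) q r := by
    have : Tendsto γ (𝓝[Icc s b \ {b}] b) (𝓝 q) := by
      rw [← hqb]
      exact (hC.continuousOn b hb).mono_left (nhdsWithin_mono _ sdiff_subset)
    exact this.eventually ((isOpen_chartBall q r).mem_nhds (mem_chartBall_self q hr.pos))
  have hne : (𝓝[Icc s b \ {b}] b).NeBot := by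
    rw [show Icc s b \ {b} = Ico s b by ext t; simp [lt_iff_le_and_ne]]
    have : b ∈ closure (Ico s b) := by rw [closure_Ico hsb.ne]; exact hb
    exact mem_closure_iff_nhdsWithin_neBot.1 this
  obtain ⟨t, ⟨ht1, ht2⟩, ht⟩ := ((hev1.and hev2).and self_mem_nhdsWithin).exists
  have htb : t < b := lt_of_le_of_ne ht.1.2 ht.2
  have hcone : extChartAt (𝓡 (n + 1)) q q - extChartAt (𝓡 (n + 1)) q (γ t) ∈ S.cone q ε := by
    have := smul_mem_cone (sub_pos.2 htb) ht1
    rw [slope_def_module, smul_smul, ← neg_sub t b, neg_mul,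
      mul_inv_cancel₀ (sub_ne_zero.2 htb.ne), neg_one_smul, neg_sub, hqb] at this
    exact this
  have hnhds : {q' | q' ∈ chartBall (n := n) q r ∧
      extChartAt (𝓡 (n + 1)) q q' - extChartAt (𝓡 (n + 1)) q (γ t) ∈ S.cone q ε} ∈ 𝓝 q := by
    refine inter_mem ((isOpen_chartBall q r).mem_nhds (mem_chartBall_self q hr.pos)) ?_
    exact ((continuousAt_extChartAt q).sub continuousAt_const).preimage_mem_nhds
      ((S.isOpen_cone q ε).mem_nhds hcone)
  filter_upwards [hnhds] with q' hq'
  have h1 := hr.chron ht2.2 hq'.1.2 hq'.2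
  rw [(extChartAt (𝓡 (n + 1)) q).left_inv ht2.1,
    (extChartAt (𝓡 (n + 1)) q).left_inv hq'.1.1] at h1
  -- When `t = a` there is no initial arc, and the segment alone joins the points.
  rcases (has.trans ht.1.1).eq_or_lt with hat | hat
  · rw [← hpa, hat]; exact h1
  · exact Chron.trans ⟨γ, a, t, hγ.restrict le_rfl hat htb.le, hpa, rfl⟩ h1

theorem isOpen_chronPast_singleton (S : SpaceTime n M) (p : M) : IsOpen {q | S.Chron q p} := by
  have := S.rev.isOpen_chronFuture p
  simpa only [chron_rev_iff] using this

theorem vec_mem_cone (S : SpaceTime n M) (c : M) :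
    ∀ᶠ ε in 𝓝[>] (0 : ℝ), S.vec c ∈ S.cone c ε :=
  S.exists_mem_cone c (S.form_vec_vec_neg c) (S.form_vec_vec_neg c)

theorem exists_chron_mem (S : SpaceTime n M) (p : M) {W : Set M} (hW : W ∈ 𝓝 p) :
    ∃ q ∈ W, S.Chron p q := by
  obtain ⟨ε, hvε, hε⟩ := ((S.vec_mem_cone p).and self_mem_nhdsWithin).exists
  obtain ⟨r, hr, hrW⟩ := S.exists_isAdapted p hε hW
  have hev : ∀ᶠ t in 𝓝[>] (0 : ℝ), extChartAt (𝓡 (n + 1)) p p + t • S.vec p ∈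
      Metric.ball (extChartAt (𝓡 (n + 1)) p p) r := by
    have h1 : Continuous (fun t : ℝ ↦ extChartAt (𝓡 (n + 1)) p p + t • S.vec p) := by fun_prop
    refine nhdsWithin_le_nhds (h1.continuousAt.preimage_mem_nhds ?_)
    simpa using Metric.ball_mem_nhds _ hr.pos
  obtain ⟨t, ht, ht0⟩ := (hev.and self_mem_nhdsWithin).exists
  refine ⟨_, hrW (hr.symm_mem_chartBall ht), ?_⟩
  have := hr.chron (Metric.mem_ball_self hr.pos) ht (by
    rw [add_sub_cancel_left]; exact smul_mem_cone ht0 hvε)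
  rwa [extChartAt_to_inv] at this

theorem exists_chron_mem_past (S : SpaceTime n M) (p : M) {W : Set M} (hW : W ∈ 𝓝 p) :
    ∃ q ∈ W, S.Chron q p := by
  simpa only [chron_rev_iff] using S.rev.exists_chron_mem p hW

/-- Every point has a neighbourhood which can be left along a timelike curve from
each of its points. -/
theorem exists_exit_nhds (S : SpaceTime n M) (c : M) :
    ∃ U : Set M, IsOpen U ∧ c ∈ U ∧ ∀ p ∈ U, ∃ q ∉ U, S.Chron p q := by
  obtain ⟨ε, hvε, hε⟩ := ((S.vec_mem_cone c).and self_mem_nhdsWithin).exists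
  obtain ⟨R, hR, -⟩ := S.exists_isAdapted c hε univ_mem
  have hRpos := hR.pos
  have hv0 : S.vec c ≠ 0 := by
    intro h0
    have := S.form_vec_vec_neg c
    simp [h0] at this
  have hvn : 0 < ‖S.vec c‖ := norm_pos_iff.2 hv0
  refine ⟨chartBall (n := n) c (R / 4), isOpen_chartBall c _,
    mem_chartBall_self c (by positivity), fun p hp ↦ ?_⟩
  set φ := extChartAt (𝓡 (n + 1)) c
  -- The displacement has norm `R / 2`: enough to leave the ball of radius `R / 4` from any of its
  -- points, and small enough to stay in the adapted ball of radius `R`.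
  set t := R / (2 * ‖S.vec c‖) with ht
  have htpos : 0 < t := by positivity
  have htn : ‖t • S.vec c‖ = R / 2 := by
    rw [norm_smul, Real.norm_eq_abs, abs_of_pos htpos, ht]
    field_simp
  have hp2 : ‖φ p - φ c‖ < R / 4 := by
    exact mem_ball_iff_norm.1 hp.2
  have hball : φ p + t • S.vec c ∈ Metric.ball (φ c) R := by
    rw [mem_ball_iff_norm]
    calc ‖φ p + t • S.vec c - φ c‖ = ‖(φ p - φ c) + t • S.vec c‖ := by congr 1; abel
      _ ≤ ‖φ p - φ c‖ + ‖t • S.vec c‖ := norm_add_le _ _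
      _ < R := by linarith
  refine ⟨φ.symm (φ p + t • S.vec c), ?_, ?_⟩
  · rintro ⟨-, h2⟩
    rw [mem_preimage, φ.right_inv (hR.subset_target hball), mem_ball_iff_norm] at h2
    have : ‖t • S.vec c‖ ≤ ‖φ p + t • S.vec c - φ c‖ + ‖φ p - φ c‖ := by
      calc ‖t • S.vec c‖ = ‖(φ p + t • S.vec c - φ c) - (φ p - φ c)‖ := by congr 1; abel
        _ ≤ _ := norm_sub_le _ _
    linarith
  · have h1 := hR.chron (e₀ := φ p) (Metric.ball_subset_ball (by linarith) hp.2) hball (by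
      rw [add_sub_cancel_left]; exact smul_mem_cone htpos hvε)
    rwa [φ.left_inv hp.1] at h1

/-! ### Inextendible curves -/

/-- Countably many of the exit neighbourhoods cover `M`. The chain is built so that each of them is
left at infinitely many scheduled steps if the chain is inside, so the chain is eventually in none
of them and cannot converge. -/
theorem exists_chain_not_tendsto [SecondCountableTopology M] {R : M → M → Prop} {A : Set M}
    (hA : ∀ c : M, ∃ U : Set M, IsOpen U ∧ c ∈ U ∧ ∀ p ∈ A, p ∈ U → ∃ q ∈ A, q ∉ U ∧ R p q)
    {p₀ : M} (hp₀ : p₀ ∈ A) :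
    ∃ p : ℕ → M, p 0 = p₀ ∧ (∀ i, p i ∈ A) ∧ (∀ i, R (p i) (p (i + 1))) ∧
      ¬ ∃ q, Tendsto p atTop (𝓝 q) := by
  choose U hUo hUc hU using hA
  obtain ⟨s, hs, hsU⟩ := TopologicalSpace.countable_cover_nhds
    (fun c ↦ (hUo c).mem_nhds (hUc c))
  have hsne : s.Nonempty := by
    have : p₀ ∈ ⋃ x ∈ s, U x := hsU ▸ mem_univ _
    simp only [mem_iUnion] at this
    obtain ⟨c, hc, -⟩ := this
    exact ⟨c, hc⟩
  obtain ⟨f, hf⟩ := hs.exists_eq_range hsne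
  have step : ∀ (c : M) (p : A), ∃ q : A, R p q ∧ ((p : M) ∈ U c → (q : M) ∉ U c) := by
    intro c p
    by_cases hp : (p : M) ∈ U c
    · obtain ⟨q, hq, h1, h2⟩ := hU c p p.2 hp
      exact ⟨⟨q, hq⟩, h2, fun _ ↦ h1⟩
    -- When `p` is not in the scheduled neighbourhood, its own one still supplies a successor.
    · obtain ⟨q, hq, h1, h2⟩ := hU p p p.2 (hUc p)
      exact ⟨⟨q, hq⟩, h2, fun h ↦ absurd h hp⟩
  choose nxt hnR hnU using step
  let seq : ℕ → A := fun i ↦ Nat.rec ⟨p₀, hp₀⟩ (fun i p ↦ nxt (f i.unpair.1) p) i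
  have hseq : ∀ i, seq (i + 1) = nxt (f i.unpair.1) (seq i) := fun i ↦ rfl
  refine ⟨fun i ↦ (seq i).1, rfl, fun i ↦ (seq i).2, fun i ↦ hnR (f i.unpair.1) (seq i), ?_⟩
  · rintro ⟨q, hq⟩
    have : q ∈ ⋃ x ∈ s, U x := hsU ▸ mem_univ _
    simp only [mem_iUnion] at this
    obtain ⟨c, hc, hqc⟩ := this
    rw [hf] at hc
    obtain ⟨j, rfl⟩ := hc
    obtain ⟨N, hN⟩ := eventually_atTop.1 (hq.eventually ((hUo (f j)).mem_nhds hqc))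
    -- Step `Nat.pair j N` is devoted to the neighbourhood of index `j` and comes no earlier than
    -- `N`.
    have h1 := hN (Nat.pair j N) (Nat.right_le_pair j N)
    have h2 := hN (Nat.pair j N + 1) ((Nat.right_le_pair j N).trans (Nat.le_succ _))
    rw [hseq, Nat.unpair_pair] at h2
    exact hnU _ _ h1 h2

theorem exists_curve_through (hP : ∀ x V, ∀ k : ℝ, 0 < k → P x V → P x (k • V)) {p : ℤ → M}
    (hp : ∀ i, ∃ (γ : ℝ → M) (a b : ℝ), IsPiecewiseC1With P γ a b ∧ γ a = p i ∧ γ b = p (i + 1)) :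
    ∃ γ : ℝ → M, (∀ a b : ℝ, a < b → IsPiecewiseC1With P γ a b) ∧ ∀ i : ℤ, γ i = p i := by
  have h1 : ∀ i : ℤ, ∃ σ : ℝ → M, IsPiecewiseC1With P σ (i : ℝ) (i + 1) ∧ σ i = p i ∧
      σ (i + 1) = p (i + 1) := by
    intro i
    obtain ⟨γ, a, b, h, h1, h2⟩ := hp i
    obtain ⟨σ, hσ, h3, h4⟩ := exists_unit_interval hP h i
    exact ⟨σ, hσ, h3.trans h1, h4.trans h2⟩
  choose σ hσ hσ0 hσ1 using h1
  let γ : ℝ → M := fun t ↦ σ ⌊t⌋ t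
  have hγi : ∀ i : ℤ, γ i = p i := fun i ↦ by simp [γ, hσ0]
  have hpiece : ∀ i : ℤ, IsPiecewiseC1With P γ (i : ℝ) (i + 1) := by
    intro i
    refine (hσ i).congr fun t ht ↦ ?_
    rcases ht.2.eq_or_lt with rfl | hlt
    · have := hγi (i + 1)
      push_cast at this
      rw [this, hσ1]
    · have : ⌊t⌋ = i := Int.floor_eq_iff.2 ⟨ht.1, hlt⟩
      simp [γ, this]
  have hlong : ∀ (i : ℤ) (k : ℕ), IsPiecewiseC1With P γ (i : ℝ) (i + (k + 1 : ℕ)) := by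
    intro i k
    induction k with
    | zero => simpa using hpiece i
    | succ k ih =>
      refine ih.trans ?_
      have := hpiece (i + (k + 1 : ℕ))
      push_cast at this ⊢
      convert this using 1
      ring
  refine ⟨γ, fun a b hab ↦ ?_, hγi⟩
  obtain ⟨k, hk⟩ := exists_nat_gt (b - ⌊a⌋)
  refine (hlong ⌊a⌋ k).restrict (Int.floor_le a) hab ?_
  push_cast
  linarith

theorem exists_future_chain [SecondCountableTopology M] (S : SpaceTime n M) (p₀ : M) :
    ∃ p : ℕ → M, p 0 = p₀ ∧ (∀ i, S.Chron (p i) (p (i + 1))) ∧ ¬ ∃ q, Tendsto p atTop (𝓝 q) := by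
  obtain ⟨p, h1, -, h2, h3⟩ := exists_chain_not_tendsto (R := S.Chron) (A := univ)
    (fun c ↦ by
      obtain ⟨U, hU, hc, h⟩ := S.exists_exit_nhds c
      refine ⟨U, hU, hc, fun p _ hp ↦ ?_⟩
      obtain ⟨q, hq, h⟩ := h p hp
      exact ⟨q, mem_univ _, hq, h⟩) (mem_univ p₀)
  exact ⟨p, h1, h2, h3⟩

theorem exists_past_chain [SecondCountableTopology M] (S : SpaceTime n M) (p₀ : M) :
    ∃ p : ℕ → M, p 0 = p₀ ∧ (∀ i, S.Chron (p (i + 1)) (p i)) ∧ ¬ ∃ q, Tendsto p atTop (𝓝 q) := by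
  simpa only [chron_rev_iff] using S.rev.exists_future_chain p₀

/-- A future and a past chain without limit points combine to an inextendible curve. -/
theorem exists_inextendible_through {S : SpaceTime n M}
    (hPS : ∀ x V, P x V → S.IsFutureDirected V)
    (hP : ∀ x V, ∀ k : ℝ, 0 < k → P x V → P x (k • V)) {p q : ℕ → M} (h0 : p 0 = q 0)
    (hp : ∀ i, ∃ (γ : ℝ → M) (a b : ℝ), IsPiecewiseC1With P γ a b ∧ γ a = p i ∧ γ b = p (i + 1))
    (hq : ∀ i, ∃ (γ : ℝ → M) (a b : ℝ), IsPiecewiseC1With P γ a b ∧ γ a = q (i + 1) ∧ γ b = q i)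
    (hpl : ¬ ∃ x, Tendsto p atTop (𝓝 x)) (hql : ¬ ∃ x, Tendsto q atTop (𝓝 x)) :
    ∃ γ : ℝ → M, S.IsInextendibleCausalCurve γ ∧
      (∀ a b : ℝ, a < b → IsPiecewiseC1With P γ a b) ∧ ∀ i : ℕ, γ i = p i := by
  let z : ℤ → M := fun i ↦ if 0 ≤ i then p i.toNat else q (-i).toNat
  have hz1 : ∀ i : ℕ, z i = p i := fun i ↦ by simp [z]
  have hz2 : ∀ i : ℕ, z (-i) = q i := by
    intro i
    rcases i.eq_zero_or_pos with rfl | hi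
    · simp [z, h0]
    · have : ¬ (0 ≤ -(i : ℤ)) := by omega
      simp only [z, if_neg this, neg_neg, Int.toNat_natCast]
  obtain ⟨γ, hγ, hγz⟩ := exists_curve_through hP (p := z) (by
    intro i
    rcases le_or_gt 0 i with hi | hi
    · obtain ⟨k, rfl⟩ := Int.eq_ofNat_of_zero_le hi
      have := hz1 (k + 1)
      push_cast at this
      rw [hz1, this]
      exact hp k
    · obtain ⟨k, hk⟩ := Int.eq_ofNat_of_zero_le (show 0 ≤ -(i + 1) by omega)
      have e1 : i = -((k + 1 : ℕ) : ℤ) := by push_cast; omega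
      have e2 : i + 1 = -(k : ℤ) := by omega
      rw [e2, hz2, e1, hz2]
      exact hq k)
  refine ⟨γ, ⟨fun a b hab ↦ (hγ a b hab).mono hPS, ?_, ?_⟩, hγ, fun i ↦ ?_⟩
  · rintro ⟨x, hx⟩
    refine hpl ⟨x, (hx.comp tendsto_natCast_atTop_atTop).congr fun i ↦ ?_⟩
    have := hγz i
    rw [hz1] at this
    exact_mod_cast this
  · rintro ⟨x, hx⟩
    refine hql ⟨x, (hx.comp (tendsto_neg_atTop_atBot.comp
      tendsto_natCast_atTop_atTop)).congr fun i ↦ ?_⟩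
    have := hγz (-i)
    rw [hz2] at this
    simpa using this
  · have := hγz i
    rw [hz1] at this
    exact_mod_cast this

/-! ### Cauchy surfaces -/

variable {S : SpaceTime n M} {Γ : Set M} [SecondCountableTopology M]

/-- Prolonged by endless chains on both sides, a causal curve from `y` to `z` would be an
inextendible one meeting `Γ` at two parameters. -/
theorem IsCauchySurface.not_causLt (hΓ : S.IsCauchySurface Γ) {y z : M} (hy : y ∈ Γ)
    (hz : z ∈ Γ) : ¬ S.CausLt y z := by
  intro hyz
  obtain ⟨p, hp0, hp, hpl⟩ := S.exists_future_chain z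
  obtain ⟨q, hq0, hq, hql⟩ := S.exists_past_chain y
  let p' : ℕ → M := fun i ↦ Nat.casesOn i y p
  obtain ⟨γ, hγ, -, hγp⟩ := exists_inextendible_through (S := S)
    (P := fun _ V ↦ S.IsFutureDirected V) (p := p') (q := q) (fun _ _ h ↦ h)
    (fun _ _ _ hk hV ↦ S.isFutureDirected_smul hk hV) (by simp [p', hq0])
    (by
      rintro (_ | i)
      · simp only [p', hp0]
        exact hyz
      · exact (hp i).causLt)
    (fun i ↦ (hq i).causLt)
    (by
      rintro ⟨x, hx⟩
      exact hpl ⟨x, (hx.comp (tendsto_add_atTop_nat 1)).congr fun i ↦ rfl⟩)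
    hql
  have h0 := hγp 0
  have h1 : γ ((1 : ℕ) : ℝ) = z := (hγp 1).trans hp0
  have := (hΓ γ hγ).unique (y₁ := ((0 : ℕ) : ℝ)) (y₂ := ((1 : ℕ) : ℝ)) (by rw [h0]; exact hy : γ _ ∈ Γ)
    (by rw [h1]; exact hz)
  norm_num at this

/-- An inextendible timelike curve with `γ 0 = x` meets `Γ`; the sign of the parameter decides the
case. -/
theorem IsCauchySurface.trichotomy (hΓ : S.IsCauchySurface Γ) (x : M) :
    x ∈ Γ ∨ (∃ y ∈ Γ, S.Chron x y) ∨ ∃ y ∈ Γ, S.Chron y x := by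
  obtain ⟨p, hp0, hp, hpl⟩ := S.exists_future_chain x
  obtain ⟨q, hq0, hq, hql⟩ := S.exists_past_chain x
  obtain ⟨γ, hγ, hγP, hγp⟩ := exists_inextendible_through (S := S)
    (P := fun _ V ↦ S.IsTimelike V ∧ S.IsFutureDirected V) (p := p) (q := q) (fun _ _ h ↦ h.2)
    (fun _ _ _ hk hV ↦ ⟨S.isTimelike_smul hk hV.1, S.isFutureDirected_smul hk hV.2⟩)
    (hp0.trans hq0.symm) hp hq hpl hql
  have h0 : γ 0 = x := by
    have := hγp 0
    rw [hp0] at this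
    exact_mod_cast this
  obtain ⟨t, ht, -⟩ := hΓ γ hγ
  rcases lt_trichotomy t 0 with h | rfl | h
  · exact Or.inr (Or.inr ⟨γ t, ht, γ, t, 0, hγP t 0 h, rfl, h0⟩)
  · exact Or.inl (h0 ▸ ht)
  · exact Or.inr (Or.inl ⟨γ t, ht, γ, 0, t, hγP 0 t h, h0, rfl⟩)

/-- So `Γ` is closed: a point off `Γ` has a whole neighbourhood chronologically related to one point
of `Γ`, which excludes `Γ` by `not_causLt`. -/
theorem IsCauchySurface.compl_mem_nhds (hΓ : S.IsCauchySurface Γ) {x : M} (hx : x ∉ Γ) :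
    Γᶜ ∈ 𝓝 x := by
  rcases (hΓ.trichotomy x).resolve_left hx with ⟨y, hy, hxy⟩ | ⟨y, hy, hyx⟩
  · filter_upwards [(S.isOpen_chronPast_singleton y).mem_nhds hxy] with z hz hzΓ
    exact hΓ.not_causLt hzΓ hy (Chron.causLt hz)
  · filter_upwards [(S.isOpen_chronFuture y).mem_nhds hyx] with z hz hzΓ
    exact hΓ.not_causLt hy hzΓ (Chron.causLt hz)

/-! ### Closedness of the causal relation -/

/-- Compact diamonds are closed in a Hausdorff space. First `p₀` is replaced by some `z ≪ p₀`, so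
that the `q i` eventually lie in one fixed diamond; then `z` tends to `p₀` inside a diamond ending
at `q₀`. -/
theorem IsGloballyHyperbolic.caus_of_tendsto [T2Space M] (hS : S.IsGloballyHyperbolic)
    {ι : Type*} {l : Filter ι} [l.NeBot] {p q : ι → M} {p₀ q₀ : M}
    (hp : Tendsto p l (𝓝 p₀)) (hq : Tendsto q l (𝓝 q₀)) (h : ∀ᶠ i in l, S.Caus (p i) (q i)) :
    S.Caus p₀ q₀ := by
  obtain ⟨q', -, hq'⟩ := S.exists_chron_mem q₀ univ_mem
  obtain ⟨p', -, hp'⟩ := S.exists_chron_mem_past p₀ univ_mem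
  have h1 : ∀ z, S.Chron z p₀ → S.Caus z q₀ := by
    intro z hz
    have hcl := (hS.2 z q').isClosed
    have : q₀ ∈ S.causalFuture z ∩ S.causalPast q' := by
      refine hcl.mem_of_tendsto hq ?_
      filter_upwards [h, hp.eventually ((S.isOpen_chronFuture z).mem_nhds hz),
        hq.eventually ((S.isOpen_chronPast_singleton q').mem_nhds hq')] with i h1 h2 h3
      exact ⟨Or.inr (h2.causLt.trans_caus h1), Or.inr h3.causLt⟩
    exact this.1
  have hcl := (hS.2 p' q₀).isClosed
  have : p₀ ∈ S.causalFuture p' ∩ S.causalPast q₀ := by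
    rw [← hcl.closure_eq, mem_closure_iff_nhds]
    intro W hW
    obtain ⟨z, hz, hzp⟩ := S.exists_chron_mem_past p₀
      (inter_mem hW ((S.isOpen_chronFuture p').mem_nhds hp'))
    exact ⟨z, hz.1, Or.inr (Chron.causLt hz.2), h1 z hzp⟩
  exact this.2

end SpaceTime

namespace SpaceTime

variable {n : ℕ} {M : Type*} [TopologicalSpace M]
  [ChartedSpace (EuclideanSpace ℝ (Fin (n + 1))) M] [IsManifold (𝓡 (n + 1)) ∞ M]
  {S : SpaceTime n M} {γ : ℝ → M} {a b : ℝ} {Γ : Set M}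

/-! ### Causal curves in adapted coordinate balls -/

theorem chartBall_subset_source {c p : M} {r : ℝ} (hp : p ∈ chartBall (n := n) c r) :
    p ∈ (chartAt (EuclideanSpace ℝ (Fin (n + 1))) c).source := by
  have := hp.1
  rwa [extChartAt_source] at this

/-- Future-directed vectors land in the slightly widened cone at the centre, which is the domain of
`exists_coercive`. -/
theorem IsAdapted.form_le {c p : M} {ε r : ℝ} (h : S.IsAdapted c ε r)
    (hp : p ∈ chartBall (n := n) c r) {V : TangentSpace (𝓡 (n + 1)) p}
    (hV : S.IsFutureDirected V) :
    S.form c (chartCoord c p V) (chartCoord c p V) ≤ ε * ‖chartCoord c p V‖ ^ 2 ∧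
      S.form c (S.vec c) (chartCoord c p V) ≤ ε * ‖chartCoord c p V‖ := by
  have h1 := (abs_le.1 (h.val_sub_le p hp V)).1
  have h2 := (abs_le.1 (h.val_X_sub_le p hp V)).1
  exact ⟨by linarith [hV.1.2], by linarith [hV.2]⟩

/-- In a small ball the speed is at most `K ‖v‖`, and coercivity bounds `‖v‖` by `-g(X, v) / κ`.
Length is thus dominated by the increment of one linear functional, which is bounded on the ball. -/
theorem exists_length_le (S : SpaceTime n M) (c : M) {W : Set M} (hW : W ∈ 𝓝 c) :
    ∃ R > 0, ∃ C ≥ 0, Metric.ball (extChartAt (𝓡 (n + 1)) c c) R ⊆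
        (extChartAt (𝓡 (n + 1)) c).target ∧ chartBall (n := n) c R ⊆ W ∧
      ∀ γ a b, S.IsCausalCurve γ a b → (∀ t ∈ Icc a b, γ t ∈ chartBall (n := n) c R) →
        S.length γ a b ≤ C := by
  obtain ⟨κ, hκ, hco⟩ := (S.isLorentzForm_form c).exists_coercive (S.form_vec_vec_neg c)
    (S.form_vec_vec_neg c) (S.form_vec_vec_neg c)
  obtain ⟨R, hR, hRW⟩ := S.exists_isAdapted c hκ hW
  obtain ⟨A, hA⟩ : ∃ A : ℝ, ∀ v, |S.form c v v| ≤ A * ‖v‖ ^ 2 :=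
    ⟨‖S.form c‖, fun v ↦ by
      have := (S.form c).le_opNorm₂ v v
      rwa [mul_assoc, ← pow_two] at this⟩
  set K := √(|A| + κ) with hK
  have hK2 : K ^ 2 = |A| + κ := Real.sq_sqrt (by positivity)
  have hK0 : 0 ≤ K := Real.sqrt_nonneg _
  let l : EuclideanSpace ℝ (Fin (n + 1)) →L[ℝ] ℝ := -((K / κ) • S.form c (S.vec c))
  have hl : ∀ v, l v = (K / κ) * (-S.form c (S.vec c) v) := fun v ↦ by
    simp only [l, FunLike.coe_neg, FunLike.coe_smul, Pi.neg_apply, Pi.smul_apply, smul_eq_mul]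
    ring
  refine ⟨R, hR.pos, ‖l‖ * (R + R), mul_nonneg (norm_nonneg _) (by linarith [hR.pos]),
    hR.subset_target, hRW, fun γ a b hγ hball ↦ ?_⟩
  have h1 := IsPiecewiseC1With.length_le S (c := c) hγ
    (fun t ht ↦ chartBall_subset_source (hball t ht)) l (by
      intro t ht V hV
      obtain ⟨h1, h2⟩ := hR.form_le (hball t ht) hV
      have h3 := hco _ h1 h2
      have h4 := (abs_le.1 (hR.val_sub_le _ (hball t ht) V)).1
      have h5 := (abs_le.1 (hA (chartCoord c (γ t) V))).1
      set v := chartCoord c (γ t) V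
      have h6 : √(-S.val (γ t) V V) ≤ K * ‖v‖ := by
        refine Real.sqrt_le_iff.2 ⟨by positivity, ?_⟩
        rw [mul_pow, hK2]
        nlinarith [le_abs_self A, sq_nonneg ‖v‖]
      rw [hl]
      calc √(-S.val (γ t) V V) ≤ K * ‖v‖ := h6
        _ = (K / κ) * (κ * ‖v‖) := by field_simp
        _ ≤ _ := by gcongr)
  have hab : a ≤ b := hγ.1.le
  have ha := (hball a (left_mem_Icc.2 hab)).2
  have hb := (hball b (right_mem_Icc.2 hab)).2
  rw [mem_preimage, mem_ball_iff_norm] at ha hb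
  rw [← map_sub] at h1
  calc S.length γ a b ≤ _ := h1
    _ ≤ ‖l‖ * ‖extChartAt (𝓡 (n + 1)) c (γ b) - extChartAt (𝓡 (n + 1)) c (γ a)‖ :=
      (le_abs_self _).trans (l.le_opNorm _)
    _ ≤ ‖l‖ * (R + R) := by
      gcongr
      calc _ = ‖(extChartAt (𝓡 (n + 1)) c (γ b) - extChartAt (𝓡 (n + 1)) c c) -
            (extChartAt (𝓡 (n + 1)) c (γ a) - extChartAt (𝓡 (n + 1)) c c)‖ := by
              congr 1; abel
        _ ≤ _ := (norm_sub_le _ _).trans (by linarith)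

theorem isCompact_symm_image {c : M} {R : ℝ} {K : Set (EuclideanSpace ℝ (Fin (n + 1)))}
    (hsub : Metric.ball (extChartAt (𝓡 (n + 1)) c c) R ⊆ (extChartAt (𝓡 (n + 1)) c).target)
    (hK : IsCompact K) (hKR : K ⊆ Metric.ball (extChartAt (𝓡 (n + 1)) c c) R) :
    IsCompact ((extChartAt (𝓡 (n + 1)) c).symm '' K) :=
  hK.image_of_continuousOn ((continuousOn_extChartAt_symm c).mono (hKR.trans hsub))

/-- A curve starting in a coordinate ball either stays there or crosses the boundary sphere. -/
theorem exists_exit_time [T2Space M] {c : M} {r R : ℝ} (hrR : r < R)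
    (hsub : Metric.ball (extChartAt (𝓡 (n + 1)) c c) R ⊆ (extChartAt (𝓡 (n + 1)) c).target)
    (hγ : ContinuousOn γ (Icc a b)) (ha : γ a ∈ chartBall (n := n) c r) :
    (∀ t ∈ Icc a b, γ t ∈ chartBall (n := n) c r) ∨
    ∃ τ ∈ Ioc a b, (∀ t ∈ Icc a τ, γ t ∈ chartBall (n := n) c R) ∧
      γ τ ∉ chartBall (n := n) c r ∧
      extChartAt (𝓡 (n + 1)) c (γ τ) ∈ Metric.sphere (extChartAt (𝓡 (n + 1)) c c) r := by
  set φ := extChartAt (𝓡 (n + 1)) c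
  by_cases hall : ∀ t ∈ Icc a b, γ t ∈ chartBall (n := n) c r
  · exact Or.inl hall
  right
  push Not at hall
  set A := Icc a b ∩ γ ⁻¹' (chartBall (n := n) c r)ᶜ with hA
  have hAc : IsCompact A := isCompact_Icc.of_isClosed_subset
    (hγ.preimage_isClosed_of_isClosed isClosed_Icc (isOpen_chartBall c r).isClosed_compl)
    inter_subset_left
  obtain ⟨τ, hτA, hτmin⟩ := hAc.exists_isLeast hall
  have hbefore : ∀ t ∈ Ico a τ, γ t ∈ chartBall (n := n) c r := by
    intro t ht
    by_contra hcon
    exact absurd (hτmin ⟨⟨ht.1, ht.2.le.trans hτA.1.2⟩, hcon⟩) (not_le.2 ht.2)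
  have haτ : a < τ := by
    refine lt_of_le_of_ne hτA.1.1 ?_
    rintro rfl
    exact hτA.2 ha
  -- Closedness, from compactness in a Hausdorff space, keeps the exit point inside the chart
  -- domain.
  have hKc : IsClosed (φ.symm '' Metric.closedBall (φ c) r) :=
    (isCompact_symm_image hsub (isCompact_closedBall _ _)
      (Metric.closedBall_subset_ball hrR)).isClosed
  have hτK : γ τ ∈ φ.symm '' Metric.closedBall (φ c) r := by
    have hcl : τ ∈ closure (Ico a τ) := by rw [closure_Ico haτ.ne]; exact right_mem_Icc.2 haτ.le
    have : ContinuousWithinAt γ (Ico a τ) τ :=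
      (hγ τ hτA.1).mono (fun t ht ↦ ⟨ht.1, ht.2.le.trans hτA.1.2⟩)
    have h1 := this.mem_closure hcl (t := φ.symm '' Metric.closedBall (φ c) r) fun t ht ↦ by
      have := hbefore t ht
      exact ⟨φ (γ t), Metric.ball_subset_closedBall this.2, φ.left_inv this.1⟩
    rwa [hKc.closure_eq] at h1
  obtain ⟨e, he, heτ⟩ := hτK
  have het : e ∈ φ.target := hsub (Metric.closedBall_subset_ball hrR he)
  have hφτ : φ (γ τ) = e := by rw [← heτ, φ.right_inv het]
  have hsrc : γ τ ∈ φ.source := by rw [← heτ]; exact φ.map_target het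
  refine ⟨τ, ⟨haτ, hτA.1.2⟩, fun t ht ↦ ?_, hτA.2, ?_⟩
  · rcases ht.2.eq_or_lt with rfl | hlt
    · exact ⟨hsrc, by rw [mem_preimage, hφτ]; exact Metric.closedBall_subset_ball hrR he⟩
    · have := hbefore t ⟨ht.1, hlt⟩
      exact ⟨this.1, Metric.ball_subset_ball hrR.le this.2⟩
  · rw [hφτ]
    have h1 : e ∉ Metric.ball (φ c) r := fun h ↦ hτA.2 ⟨hsrc, by rwa [mem_preimage, hφτ]⟩
    rw [Metric.mem_sphere]
    exact le_antisymm he (not_lt.1 h1)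

/-! ### Boundedness of the lengths of causal curves to a Cauchy surface -/

/-- Points from which some causal curve to `Γ` has length minus final cost larger than `N`. -/
def largeCost (S : SpaceTime n M) (Γ : Set M) (φ : Γ → ℝ) (N : ℝ) : Set M :=
  {p | ∃ (y : Γ) (γ : ℝ → M) (a b : ℝ), S.IsCausalCurve γ a b ∧ γ a = p ∧ γ b = y ∧
    N < S.length γ a b - φ y}

theorem largeCost_anti {φ : Γ → ℝ} {N N' : ℝ} (h : N ≤ N') :
    S.largeCost Γ φ N' ⊆ S.largeCost Γ φ N := by
  rintro p ⟨y, γ, a, b, h1, h2, h3, h4⟩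
  exact ⟨y, γ, a, b, h1, h2, h3, h.trans_lt h4⟩

/-- Near `c` both length and `-φ` are bounded, so curves of huge value starting near `p` must cross
a sphere around `c`, and what remains after crossing is still of huge value. Compactness of the
sphere gives a limit point `q`, and closedness of the causal relation gives `p < q`. -/
theorem exists_large_of_large [T2Space M] [SecondCountableTopology M]
    (hS : S.IsGloballyHyperbolic) {φ : Γ → ℝ}
    (hφ : ∀ c : M, ∃ W ∈ 𝓝 c, ∃ K : ℝ, ∀ y : Γ, (y : M) ∈ W → -K ≤ φ y) (c : M) :
    ∃ U : Set M, IsOpen U ∧ c ∈ U ∧ ∀ p ∈ {p | ∀ N, p ∈ closure (S.largeCost Γ φ N)}, p ∈ U →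
      ∃ q ∈ {p | ∀ N, p ∈ closure (S.largeCost Γ φ N)}, q ∉ U ∧ S.CausLt p q := by
  obtain ⟨W, hW, K, hK⟩ := hφ c
  obtain ⟨R, hR, C, hC0, hsub, hRW, hC⟩ := S.exists_length_le c hW
  set r := R / 2 with hr
  have hr0 : 0 < r := by positivity
  have hrR : r < R := by linarith
  have hrsub : chartBall (n := n) c r ⊆ chartBall (n := n) c R := fun p hp ↦
    ⟨hp.1, Metric.ball_subset_ball hrR.le hp.2⟩
  refine ⟨chartBall (n := n) c r, isOpen_chartBall c r, mem_chartBall_self c hr0, ?_⟩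
  intro p hp hpU
  obtain ⟨V, hV⟩ := (𝓝 p).exists_antitone_basis
  -- The excess `C + K` pays for the arc inside the ball (at most `C`) and, should the curve end
  -- there, for `-φ` (at most `K`).
  have hex : ∀ N : ℕ, ∃ z ∈ S.largeCost Γ φ (N + (C + K)),
      z ∈ V N ∩ chartBall (n := n) c r := by
    intro N
    obtain ⟨z, hz1, hz2⟩ := mem_closure_iff_nhds.1 (hp (N + (C + K)))
      (V N ∩ chartBall (n := n) c r)
      (inter_mem (hV.mem N) ((isOpen_chartBall c r).mem_nhds hpU))
    exact ⟨z, hz2, hz1⟩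
  choose z hzL hzV using hex
  have hz : Tendsto z atTop (𝓝 p) := hV.tendsto fun N ↦ (hzV N).1
  set φc := extChartAt (𝓡 (n + 1)) c
  have hexit : ∀ N : ℕ, ∃ q ∈ φc.symm '' Metric.sphere (φc c) r, S.Caus (z N) q ∧
      q ∈ S.largeCost Γ φ (N + K) := by
    intro N
    obtain ⟨y, γ, a, b, hγ, haz, hby, hN⟩ := hzL N
    have hab : a < b := hγ.1
    have hnot : ¬ ∀ t ∈ Icc a b, γ t ∈ chartBall (n := n) c R := by
      intro hin
      have h1 := hC γ a b hγ hin
      have h2 := hK y (hRW (hby ▸ hin b (right_mem_Icc.2 hab.le)))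
      have : (0 : ℝ) ≤ N := N.cast_nonneg
      linarith
    rcases exists_exit_time hrR hsub hγ.2.1 (haz ▸ (hzV N).2) with
      hin | ⟨τ, hτ, hin, -, hsph⟩
    · exact absurd (fun t ht ↦ hrsub (hin t ht)) hnot
    · have hτb : τ < b := lt_of_le_of_ne hτ.2 (by rintro rfl; exact hnot hin)
      have hh := hγ.restrict le_rfl hτ.1 hτ.2
      have h1 := hC γ a τ hh hin
      have h2 := IsPiecewiseC1With.length_add S hγ hτ.1.le hτ.2
      refine ⟨γ τ, ⟨φc (γ τ), hsph, φc.left_inv (hin τ (right_mem_Icc.2 hτ.1.le)).1⟩,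
        Or.inr ⟨γ, a, τ, hh, haz, rfl⟩, y, γ, τ, b, hγ.restrict hτ.1.le hτb le_rfl, rfl, hby, ?_⟩
      linarith
  choose q hqS hzq hqL using hexit
  have hcomp : IsCompact (φc.symm '' Metric.sphere (φc c) r) :=
    isCompact_symm_image hsub (isCompact_sphere _ _)
      (Metric.sphere_subset_closedBall.trans (Metric.closedBall_subset_ball hrR))
  obtain ⟨q₀, hq₀, ψ, hψ, hψq⟩ := hcomp.tendsto_subseq hqS
  have hq₀U : q₀ ∉ chartBall (n := n) c r := by
    obtain ⟨e, he, rfl⟩ := hq₀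
    rintro ⟨-, h2⟩
    have het : e ∈ φc.target := hsub (Metric.closedBall_subset_ball hrR
      (Metric.sphere_subset_closedBall he))
    rw [mem_preimage, φc.right_inv het] at h2
    rw [Metric.mem_sphere] at he
    rw [Metric.mem_ball] at h2
    linarith
  refine ⟨q₀, fun N ↦ ?_, hq₀U, ?_⟩
  · refine mem_closure_of_tendsto hψq ?_
    obtain ⟨k, hk⟩ := exists_nat_ge (N - K)
    filter_upwards [hψ.tendsto_atTop.eventually_ge_atTop k] with i hi
    have : (k : ℝ) ≤ ψ i := by exact_mod_cast hi
    exact largeCost_anti (by linarith) (hqL (ψ i))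
  · have h1 := hS.caus_of_tendsto (hz.comp hψ.tendsto_atTop) hψq
      (Eventually.of_forall fun i ↦ hzq (ψ i))
    rcases h1 with rfl | h1
    · exact absurd hpU hq₀U
    · exact h1

/-- Iterating `exists_large_of_large` yields an inextendible causal curve whose integer points are
all limits of points with causal curves to `Γ`. It meets `Γ`, and a later integer point lies in the
open set `I⁺[Γ]`, from which no causal curve reaches `Γ`. -/
theorem exists_forall_length_sub_le [T2Space M] [SecondCountableTopology M]
    (hS : S.IsGloballyHyperbolic) (hΓ : S.IsCauchySurface Γ) {φ : Γ → ℝ}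
    (hφ : ∀ c : M, ∃ W ∈ 𝓝 c, ∃ K : ℝ, ∀ y : Γ, (y : M) ∈ W → -K ≤ φ y) (x : M) :
    ∃ N : ℝ, ∀ (y : Γ) (γ : ℝ → M) (a b : ℝ), S.IsCausalCurve γ a b → γ a = x → γ b = y →
      S.length γ a b - φ y ≤ N := by
  by_contra! hcon
  have hx : x ∈ {p | ∀ N, p ∈ closure (S.largeCost Γ φ N)} := by
    intro N
    obtain ⟨y, γ, a, b, h1, h2, h3, h4⟩ := hcon N
    exact subset_closure ⟨y, γ, a, b, h1, h2, h3, h4⟩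
  obtain ⟨p, hp0, hpB, hp, hpl⟩ := exists_chain_not_tendsto (exists_large_of_large hS hφ) hx
  obtain ⟨q, hq0, hq, hql⟩ := S.exists_past_chain x
  obtain ⟨γ, hγ, hγP, hγp⟩ := exists_inextendible_through (S := S)
    (P := fun _ V ↦ S.IsFutureDirected V) (p := p) (q := q) (fun _ _ h ↦ h)
    (fun _ _ _ hk hV ↦ S.isFutureDirected_smul hk hV) (hp0.trans hq0.symm) hp
    (fun i ↦ (hq i).causLt) hpl hql
  obtain ⟨t, ht, -⟩ := hΓ γ hγ
  obtain ⟨i, hi⟩ := exists_nat_gt t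
  have hlt : S.CausLt (γ t) (γ i) := ⟨γ, t, i, hγP t i hi, rfl, rfl⟩
  have hbad : ∀ N, γ i ∈ closure (S.largeCost Γ φ N) := (hγp i).symm ▸ hpB i
  rcases hΓ.trichotomy (γ i) with h | ⟨y, hy, h⟩ | ⟨y, hy, h⟩
  · exact hΓ.not_causLt ht h hlt
  · exact hΓ.not_causLt ht hy (hlt.trans h.causLt)
  · obtain ⟨z, hz, y', σ, a, b, hσ, haz, hby, -⟩ := mem_closure_iff_nhds.1 (hbad 0) _
      ((S.isOpen_chronFuture y).mem_nhds h)
    exact hΓ.not_causLt hy y'.2 ((Chron.causLt hz).trans ⟨σ, a, b, hσ, haz, hby⟩)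

end SpaceTime

/-! ### Local boundedness of locally Lipschitz functions -/

theorem eventually_riemDist_lt_one {n : ℕ} {M : Type*} [TopologicalSpace M]
    [ChartedSpace (EuclideanSpace ℝ (Fin (n + 1))) M] [IsManifold (𝓡 (n + 1)) ∞ M]
    (h : ContMDiffRiemannianMetric (𝓡 (n + 1)) ∞ (EuclideanSpace ℝ (Fin (n + 1)))
      (fun x : M ↦ TangentSpace (𝓡 (n + 1)) x)) (y : M) :
    ∀ᶠ z in 𝓝 y, riemDist h y z < 1 := by
  let _ : RiemannianBundle (fun x : M ↦ TangentSpace (𝓡 (n + 1)) x) := ⟨h.toRiemannianMetric⟩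
  have : IsContinuousRiemannianBundle (EuclideanSpace ℝ (Fin (n + 1)))
      (fun x : M ↦ TangentSpace (𝓡 (n + 1)) x) :=
    ⟨⟨h.inner, h.contMDiff.continuous, fun _ _ _ ↦ rfl⟩⟩
  exact eventually_riemannianEDist_lt (𝓡 (n + 1)) y one_pos

/-- Only this local lower bound on `φ` enters the proof. Off `Γ` it is vacuous, because `Γ` is
closed. -/
theorem IsLocLipschitz.exists_le {n : ℕ} {M : Type*} [TopologicalSpace M]
    [SecondCountableTopology M]
    [ChartedSpace (EuclideanSpace ℝ (Fin (n + 1))) M] [IsManifold (𝓡 (n + 1)) ∞ M]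
    {S : SpaceTime n M} {Γ : Set M} (hΓ : S.IsCauchySurface Γ)
    {h : ContMDiffRiemannianMetric (𝓡 (n + 1)) ∞ (EuclideanSpace ℝ (Fin (n + 1)))
      (fun x : M ↦ TangentSpace (𝓡 (n + 1)) x)} {φ : Γ → ℝ} (hφ : IsLocLipschitz h Γ φ) (c : M) :
    ∃ W ∈ 𝓝 c, ∃ K : ℝ, ∀ y : Γ, (y : M) ∈ W → -K ≤ φ y := by
  by_cases hc : c ∈ Γ
  · obtain ⟨U, hU, K, hK⟩ := hφ ⟨c, hc⟩
    refine ⟨_, inter_mem hU (eventually_riemDist_lt_one h c), K - φ ⟨c, hc⟩, fun y hy ↦ ?_⟩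
    have h1 := hK ⟨c, hc⟩ y (mem_of_mem_nhds hU) hy.1
    have h2 : ENNReal.ofReal |φ ⟨c, hc⟩ - φ y| ≤ K := by
      refine h1.trans ?_
      calc (K : ℝ≥0∞) * riemDist h c y ≤ K * 1 := by
            gcongr
            exact le_of_lt hy.2
        _ = K := mul_one _
    have h3 : |φ ⟨c, hc⟩ - φ y| ≤ K := by
      rw [← ENNReal.ofReal_coe_nnreal] at h2
      exact (ENNReal.ofReal_le_ofReal_iff K.2).1 h2
    linarith [(abs_le.1 h3).2]
  · exact ⟨Γᶜ, hΓ.compl_mem_nhds hc, 0, fun y hy ↦ absurd y.2 hy⟩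

namespace SpaceTime

variable {n : ℕ} {M : Type*} [TopologicalSpace M]
  [ChartedSpace (EuclideanSpace ℝ (Fin (n + 1))) M] [IsManifold (𝓡 (n + 1)) ∞ M]
  {S : SpaceTime n M} {γ : ℝ → M} {a b : ℝ} {Γ : Set M} {φ : Γ → ℝ}

/-! ### The value function -/

/-- The bound keeps `sSup` and `sInf` away from their default values; `x ∉ Γ` rules out the constant
curve, to which the bound does not apply. -/
theorem uSol_le {x : M} (hx : x ∉ Γ)
    (hbd : ∃ N : ℝ, ∀ (y : Γ) (γ : ℝ → M) (a b : ℝ), S.IsCausalCurve γ a b → γ a = x →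
      γ b = y → S.length γ a b - φ y ≤ N)
    {y : Γ} (hγ : S.IsCausalCurve γ a b) (ha : γ a = x) (hb : γ b = y) :
    S.uSol Γ φ x ≤ φ y - S.length γ a b := by
  obtain ⟨N, hN⟩ := hbd
  have hmem : ∀ (z : Γ) (l : ℝ), ((x = z ∧ l = 0) ∨ ∃ (γ : ℝ → M) (a b : ℝ),
      S.IsCausalCurve γ a b ∧ γ a = x ∧ γ b = z ∧ l = S.length γ a b) → l ≤ N + φ z := by
    rintro z l (⟨h, -⟩ | ⟨σ, s, t, h1, h2, h3, rfl⟩)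
    · exact absurd (h ▸ z.2) hx
    · linarith [hN z σ s t h1 h2 h3]
  have h1 : S.length γ a b ≤ S.dist x y :=
    le_csSup ⟨N + φ y, fun l hl ↦ hmem y l hl⟩ (Or.inr ⟨γ, a, b, hγ, ha, hb, rfl⟩)
  have h2 : S.uSol Γ φ x ≤ φ y - S.dist x y := by
    refine csInf_le ⟨-N, ?_⟩ ⟨y, Or.inr ⟨γ, a, b, hγ, ha, hb⟩, rfl⟩
    rintro r ⟨z, hz, rfl⟩
    have hne : {l : ℝ | (x = z ∧ l = 0) ∨ ∃ (γ : ℝ → M) (a b : ℝ),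
        S.IsCausalCurve γ a b ∧ γ a = x ∧ γ b = z ∧ l = S.length γ a b}.Nonempty := by
      rcases hz with h | ⟨σ, s, t, h1, h2, h3⟩
      · exact ⟨0, Or.inl ⟨h, rfl⟩⟩
      · exact ⟨_, Or.inr ⟨σ, s, t, h1, h2, h3, rfl⟩⟩
    have : S.dist x z ≤ N + φ z := csSup_le hne fun l hl ↦ hmem z l hl
    linarith
  linarith

/-- Half of `ε` is spent on the infimum over `y`, half on the supremum over curves. -/
theorem exists_lt_uSol_add {x y₀ : M} (hx : x ∉ Γ) (hy₀ : y₀ ∈ Γ) (hxy : S.CausLt x y₀)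
    {ε : ℝ} (hε : 0 < ε) :
    ∃ (y : Γ) (γ : ℝ → M) (a b : ℝ), S.IsCausalCurve γ a b ∧ γ a = x ∧ γ b = y ∧
      φ y - S.length γ a b < S.uSol Γ φ x + ε := by
  have hne : {r : ℝ | ∃ y : Γ, (y : M) ∈ S.causalFuture x ∧ r = φ y - S.dist x y}.Nonempty :=
    ⟨_, ⟨y₀, hy₀⟩, Or.inr hxy, rfl⟩
  obtain ⟨r, ⟨y, hy, rfl⟩, hr⟩ := exists_lt_of_csInf_lt hne
    (show S.uSol Γ φ x < S.uSol Γ φ x + ε / 2 by linarith)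
  rcases hy with h | ⟨σ, s, t, h1, h2, h3⟩
  · exact absurd (h ▸ y.2) hx
  obtain ⟨l, hl, hlt⟩ := exists_lt_of_lt_csSup (b := S.dist x y - ε / 2)
    (s := {l : ℝ | (x = y ∧ l = 0) ∨ ∃ (γ : ℝ → M) (a b : ℝ),
        S.IsCausalCurve γ a b ∧ γ a = x ∧ γ b = y ∧ l = S.length γ a b})
    ⟨_, Or.inr ⟨σ, s, t, h1, h2, h3, rfl⟩⟩ (show S.dist x y - ε / 2 < S.dist x y by linarith)
  rcases hl with ⟨h, -⟩ | ⟨γ, a, b, h1, h2, h3, rfl⟩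
  · exact absurd (h ▸ y.2) hx
  · exact ⟨y, γ, a, b, h1, h2, h3, by linarith⟩

/-- One half of dynamic programming: a curve from `x` to `z` is prefixed to a nearly optimal one
from `z`. Its end parameter is free, so lengths never have to be reparametrized. -/
theorem uSol_add_le {x z y₀ : M} {L : ℝ} (hx : x ∉ Γ) (hz : z ∉ Γ) (hy₀ : y₀ ∈ Γ)
    (hzy : S.CausLt z y₀)
    (hbd : ∃ N : ℝ, ∀ (y : Γ) (γ : ℝ → M) (a b : ℝ), S.IsCausalCurve γ a b → γ a = x →
      γ b = y → S.length γ a b - φ y ≤ N)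
    (h : ∀ t : ℝ, ∃ (σ : ℝ → M) (s : ℝ), S.IsCausalCurve σ s t ∧ σ s = x ∧ σ t = z ∧
      L ≤ S.length σ s t) :
    S.uSol Γ φ x + L ≤ S.uSol Γ φ z := by
  refine le_of_forall_pos_le_add fun ε hε ↦ ?_
  obtain ⟨y, γ, a, b, hγ, ha, hb, hlt⟩ := exists_lt_uSol_add (φ := φ) hz hy₀ hzy hε
  obtain ⟨σ, s, hσ, hs, ht, hL⟩ := h a
  have hsa : s < a := hσ.1
  have hab : a < b := hγ.1
  have hcat : S.IsCausalCurve (fun t ↦ if t ≤ a then σ t else γ t) s b :=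
    IsPiecewiseC1With.trans' hσ hγ (ht.trans ha.symm)
  have h1 := uSol_le hx hbd (y := y) hcat (by simp [hsa.le, hs]) (by simp [hab, hb])
  have h2 := IsPiecewiseC1With.length_add S hcat hsa.le hab.le
  have h3 : S.length (fun t ↦ if t ≤ a then σ t else γ t) s a = S.length σ s a :=
    S.length_congr hsa.le fun t ht ↦ if_pos ht.2
  have h4 : S.length (fun t ↦ if t ≤ a then σ t else γ t) a b = S.length γ a b := by
    refine S.length_congr hab.le fun t htt ↦ ?_
    rcases htt.1.eq_or_lt with rfl | hlt
    · simp [ht, ha]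
    · exact if_neg (not_le.2 hlt)
  linarith

/-! ### The gradient of the value function -/

/-- In the preferred chart at `x` the manifold derivative is, by definition, the derivative of the
coordinate expression. -/
theorem exists_hasFDerivAt {u : M → ℝ} {x : M}
    (hu : MDifferentiableAt (𝓡 (n + 1)) 𝓘(ℝ, ℝ) u x) :
    ∃ l : EuclideanSpace ℝ (Fin (n + 1)) →L[ℝ] ℝ,
      HasFDerivAt (fun e ↦ u ((extChartAt (𝓡 (n + 1)) x).symm e)) l
        (extChartAt (𝓡 (n + 1)) x x) ∧
      ∀ v : EuclideanSpace ℝ (Fin (n + 1)), S.form x (S.grad u x) v = l v := by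
  refine ⟨mfderiv (𝓡 (n + 1)) 𝓘(ℝ, ℝ) u x, ?_, fun v ↦ S.val_grad u x v⟩
  have h1 := hu.hasMFDerivAt.2
  have h2 : range (𝓡 (n + 1)) = univ := ModelWithCorners.Boundaryless.range_eq_univ
  rw [h2] at h1
  exact hasFDerivWithinAt_univ.1 h1

/-- The coordinate segment from `x` with velocity `V` has length at least `t √(-g(V,V) - ε ‖V‖²)`,
so `uSol_add_le` bounds the difference quotients below; then `t → 0`, and after that `ε → 0`. -/
theorem sqrt_le_fderiv_uSol [SecondCountableTopology M] (hΓ : S.IsCauchySurface Γ)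
    (hbd : ∀ x : M, ∃ N : ℝ, ∀ (y : Γ) (γ : ℝ → M) (a b : ℝ), S.IsCausalCurve γ a b → γ a = x →
      γ b = y → S.length γ a b - φ y ≤ N)
    {x y₀ : M} (hy₀ : y₀ ∈ Γ) (hxy : S.Chron x y₀)
    {l : EuclideanSpace ℝ (Fin (n + 1)) →L[ℝ] ℝ}
    (hl : HasFDerivAt (fun e ↦ S.uSol Γ φ ((extChartAt (𝓡 (n + 1)) x).symm e)) l
        (extChartAt (𝓡 (n + 1)) x x))
    {V : EuclideanSpace ℝ (Fin (n + 1))} (hV : S.form x V V < 0)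
    (hXV : S.form x (S.vec x) V < 0) : √(-S.form x V V) ≤ l V := by
  set ψ := extChartAt (𝓡 (n + 1)) x with hψ
  have hnotΓ : ∀ z, S.Chron z y₀ → z ∉ Γ := fun z hz hzΓ ↦ hΓ.not_causLt hzΓ hy₀ hz.causLt
  have hder : HasDerivAt (fun t : ℝ ↦ S.uSol Γ φ (ψ.symm (ψ x + t • V))) (l V) 0 := by
    have h1 : HasDerivAt (fun t : ℝ ↦ ψ x + t • V) ((1 : ℝ) • V) 0 :=
      ((hasDerivAt_id (0 : ℝ)).smul_const V).const_add (ψ x)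
    rw [one_smul] at h1
    have h2 : HasFDerivAt (fun e ↦ S.uSol Γ φ (ψ.symm e)) l (ψ x + (0 : ℝ) • V) := by
      simpa using hl
    exact h2.comp_hasDerivAt (0 : ℝ) h1
  have hslope := (hasDerivWithinAt_iff_tendsto_slope' (by simp)).1
    (hder.hasDerivWithinAt (s := Ioi 0))
  have hkey : ∀ᶠ ε in 𝓝[>] (0 : ℝ), √(-S.form x V V - ε * ‖V‖ ^ 2) ≤ l V := by
    filter_upwards [S.exists_mem_cone x hV hXV, self_mem_nhdsWithin] with ε hVε hε
    obtain ⟨r, hr, hrW⟩ := S.exists_isAdapted x hε ((S.isOpen_chronPast_singleton y₀).mem_nhds hxy)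
    refine ge_of_tendsto hslope ?_
    have hev : ∀ᶠ t in 𝓝[>] (0 : ℝ), ψ x + t • V ∈ Metric.ball (ψ x) r := by
      have h1 : Continuous (fun t : ℝ ↦ ψ x + t • V) := by fun_prop
      refine nhdsWithin_le_nhds (h1.continuousAt.preimage_mem_nhds ?_)
      simpa using Metric.ball_mem_nhds _ hr.pos
    filter_upwards [hev, self_mem_nhdsWithin] with t ht ht0
    have ht0' : 0 < t := ht0
    have hball := Metric.mem_ball_self (x := ψ x) hr.pos
    have hz : S.Chron (ψ.symm (ψ x + t • V)) y₀ := hrW (hr.symm_mem_chartBall ht)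
    have h1 := uSol_add_le (φ := φ) (L := t * √(-S.form x V V - ε * ‖V‖ ^ 2))
      (hnotΓ x hxy) (hnotΓ _ hz) hy₀ hz.causLt (hbd x) (fun s ↦ by
        have e1 := hr.isTimelikeCurve_chartLine (s := s - t) ht0' hball ht hVε
        have e2 := hr.le_length_chartLine (s := s - t) ht0' hball ht hVε
        rw [sub_add_cancel] at e1 e2
        refine ⟨_, _, e1.isCausalCurve, ?_, ?_, e2⟩
        · rw [chartLine, sub_self, zero_smul, add_zero]
          exact extChartAt_to_inv x
        · rw [chartLine, sub_sub_cancel])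
    have h2 : ψ.symm (ψ x + (0 : ℝ) • V) = x := by simp [hψ]
    rw [slope_def_field, h2, sub_zero, le_div_iff₀ ht0']
    linarith
  refine le_of_tendsto ?_ hkey
  have hc : Continuous (fun ε : ℝ ↦ √(-S.form x V V - ε * ‖V‖ ^ 2)) := by fun_prop
  have := hc.tendsto 0
  simp only [zero_mul, sub_zero] at this
  exact this.mono_left nhdsWithin_le_nhds

/-- Estimates for causal curves near `x` in terms of a past directed timelike covector `l` of
Lorentzian norm bigger than one. -/
theorem exists_length_le_of_lt_neg_one (S : SpaceTime n M) (x : M)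
    {G : EuclideanSpace ℝ (Fin (n + 1))} (hG : S.form x G G < -1)
    (hXG : 0 < S.form x (S.vec x) G) {W : Set M} (hW : W ∈ 𝓝 x) :
    ∃ R > 0, ∃ κ > 0, ∃ ρ < 1, 0 ≤ ρ ∧ Metric.ball (extChartAt (𝓡 (n + 1)) x x) R ⊆
        (extChartAt (𝓡 (n + 1)) x).target ∧ chartBall (n := n) x R ⊆ W ∧
      ∀ γ a b, S.IsCausalCurve γ a b → (∀ t ∈ Icc a b, γ t ∈ chartBall (n := n) x R) →
        S.length γ a b ≤ ρ * S.form x G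
          (extChartAt (𝓡 (n + 1)) x (γ b) - extChartAt (𝓡 (n + 1)) x (γ a)) ∧
        κ * ‖extChartAt (𝓡 (n + 1)) x (γ b) - extChartAt (𝓡 (n + 1)) x (γ a)‖ ≤ S.form x G
          (extChartAt (𝓡 (n + 1)) x (γ b) - extChartAt (𝓡 (n + 1)) x (γ a)) := by
  have hB := S.isLorentzForm_form x
  set B := S.form x with hBdef
  set l : EuclideanSpace ℝ (Fin (n + 1)) →L[ℝ] ℝ := B G with hl
  obtain ⟨κ, hκ, hco⟩ := hB.exists_coercive (X := S.vec x) (N := -G) (S.form_vec_vec_neg x)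
    (by simp only [map_neg, FunLike.coe_neg, Pi.neg_apply, neg_neg]; linarith) (by simpa using hXG)
  simp only [map_neg, FunLike.coe_neg, Pi.neg_apply, neg_neg] at hco
  set ν := √(-B G G) with hν
  have hν2 : ν ^ 2 = -B G G := Real.sq_sqrt (by linarith)
  have hν1 : 1 < ν := by
    rw [hν, Real.lt_sqrt zero_le_one]
    linarith
  set θ := 1 / ν with hθ
  have hθ1 : θ < 1 := by rw [hθ, div_lt_one (by linarith)]; exact hν1
  have hθ0 : 0 < θ := by positivity
  -- Reverse Cauchy–Schwarz gives the factor `θ` at `x`. As `ε ≤ m²`, moving away from `x` costs at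
  -- most `m ‖v‖ ≤ (1 - θ) / 2 * l v`, half the slack, which leaves the factor `(1 + θ) / 2 < 1`.
  set m := κ * (1 - θ) / 2 with hm
  have hm0 : 0 < m := by
    have : 0 < 1 - θ := by linarith
    positivity
  set ε := min κ (m ^ 2) with hε
  have hε0 : 0 < ε := lt_min hκ (by positivity)
  obtain ⟨R, hR, hRW⟩ := S.exists_isAdapted x hε0 hW
  have hcoV : ∀ p ∈ chartBall (n := n) x R, ∀ V : TangentSpace (𝓡 (n + 1)) p,
      S.IsFutureDirected V → κ * ‖chartCoord x p V‖ ≤ l (chartCoord x p V) := by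
    intro p hp V hV
    obtain ⟨h1, h2⟩ := hR.form_le hp hV
    refine hco _ (h1.trans ?_) (h2.trans ?_)
    · exact mul_le_mul_of_nonneg_right (min_le_left _ _) (sq_nonneg _)
    · exact mul_le_mul_of_nonneg_right (min_le_left _ _) (norm_nonneg _)
  have hsp : ∀ p ∈ chartBall (n := n) x R, ∀ V : TangentSpace (𝓡 (n + 1)) p,
      S.IsFutureDirected V → √(-S.val p V V) ≤ ((1 + θ) / 2) * l (chartCoord x p V) := by
    intro p hp V hV
    have h1 := hcoV p hp V hV
    have h2 := (abs_le.1 (hR.val_sub_le p hp V)).1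
    set v := chartCoord x p V
    have hlv : 0 ≤ l v := le_trans (by positivity) h1
    have h3 := hB.mul_le_sq (T := G) (by linarith) v
    have h4 : -B v v ≤ (θ * l v) ^ 2 := by
      have hν0 : 0 < ν ^ 2 := by positivity
      have h5 : -B v v * ν ^ 2 ≤ l v ^ 2 := by rw [hν2, hl]; linarith
      rw [hθ, mul_pow, div_pow, one_pow, one_div_mul_eq_div, le_div_iff₀ hν0]
      exact h5
    have h5 : ε * ‖v‖ ^ 2 ≤ (m * ‖v‖) ^ 2 := by
      rw [mul_pow]
      exact mul_le_mul_of_nonneg_right (min_le_right _ _) (sq_nonneg _)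
    have h6 : √(-S.val p V V) ≤ θ * l v + m * ‖v‖ := by
      refine Real.sqrt_le_iff.2 ⟨by positivity, ?_⟩
      have h7 : 0 ≤ (θ * l v) * (m * ‖v‖) := by positivity
      nlinarith
    have h7 : m * ‖v‖ ≤ (1 - θ) / 2 * l v := by
      have : m * ‖v‖ = (1 - θ) / 2 * (κ * ‖v‖) := by rw [hm]; ring
      rw [this]
      exact mul_le_mul_of_nonneg_left h1 (by linarith)
    calc √(-S.val p V V) ≤ θ * l v + m * ‖v‖ := h6
      _ ≤ θ * l v + (1 - θ) / 2 * l v := by linarith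
      _ = _ := by ring
  refine ⟨R, hR.pos, κ, hκ, (1 + θ) / 2, by linarith, by linarith, hR.subset_target, hRW,
    fun γ a b hγ hball ↦ ?_⟩
  set ψ := extChartAt (𝓡 (n + 1)) x
  set D := ψ (γ b) - ψ (γ a) with hD
  have hsrc := fun t ht ↦ chartBall_subset_source (hball t ht)
  constructor
  · have h1 := IsPiecewiseC1With.length_le S (c := x) hγ hsrc (((1 + θ) / 2) • l)
      (fun t ht V hV ↦ by simpa using hsp _ (hball t ht) V hV)
    have h2 : (((1 + θ) / 2) • l) D = (1 + θ) / 2 * l D := by simp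
    rwa [← map_sub, ← hD, h2] at h1
  · rcases eq_or_ne D 0 with h0 | h0
    · rw [h0]; simp
    have hDn : 0 < ‖D‖ := norm_pos_iff.2 h0
    -- Coercivity makes `k` nonnegative on future-directed velocities, so its increment `k D` should
    -- be nonnegative. This is extracted from `length_le`: adding any `T • k` with `T ≥ 0` keeps the
    -- functional dominating, and lengths are nonnegative.
    set k : EuclideanSpace ℝ (Fin (n + 1)) →L[ℝ] ℝ := l - κ • ((‖D‖⁻¹) • innerSL ℝ D) with hk
    have hkD : k D = l D - κ * ‖D‖ := by
      simp only [hk, FunLike.coe_sub, FunLike.coe_smul, Pi.sub_apply, Pi.smul_apply,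
        innerSL_apply_apply, real_inner_self_eq_norm_sq, smul_eq_mul]
      field_simp
    by_contra! hlt
    have hkneg : k D < 0 := by rw [hkD]; linarith
    have hT : ∀ T : ℝ, 0 ≤ T → 0 ≤ ((1 + θ) / 2) * l D + T * k D := by
      intro T hT
      have h1 := IsPiecewiseC1With.length_le S (c := x) hγ hsrc (((1 + θ) / 2) • l + T • k)
        (fun t ht V hV ↦ by
          have h2 := hsp _ (hball t ht) V hV
          have h3 := hcoV _ (hball t ht) V hV
          set v := chartCoord x (γ t) V
          have h4 : 0 ≤ k v := by
            have h5 : ‖D‖⁻¹ * inner ℝ D v ≤ ‖v‖ := by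
              calc ‖D‖⁻¹ * inner ℝ D v ≤ ‖D‖⁻¹ * (‖D‖ * ‖v‖) := by
                    gcongr
                    exact real_inner_le_norm D v
                _ = ‖v‖ := by field_simp
            have h6 : k v = l v - κ * (‖D‖⁻¹ * inner ℝ D v) := by
              simp [hk]
            rw [h6]
            nlinarith
          have h5 : 0 ≤ T * k v := mul_nonneg hT h4
          have h6 : (((1 + θ) / 2) • l + T • k) v = ((1 + θ) / 2) * l v + T * k v := by simp
          rw [h6]
          linarith)
      rw [← map_sub] at h1
      have h2 : (((1 + θ) / 2) • l + T • k) D = ((1 + θ) / 2) * l D + T * k D := by simp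
      rw [← hD, h2] at h1
      exact (S.length_nonneg hγ.1.le).trans h1
    have := hT ((|((1 + θ) / 2) * l D| + 1) / (-k D)) (div_nonneg (by positivity) (by linarith))
    rw [div_neg, neg_mul, div_mul_cancel₀ _ hkneg.ne] at this
    linarith [le_abs_self (((1 + θ) / 2) * l D)]

/-- Along the initial arc of a nearly optimal curve, `u` grows by at most its length plus a
tolerance, hence by at most `ρ l D` plus that tolerance with `ρ < 1`. Differentiability demands
nearly `l D`, and `l D ≥ κ ‖D‖` makes the gap linear in the radius. -/
theorem neg_one_le_of_hasFDerivAt_uSol [T2Space M] [SecondCountableTopology M]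
    (hΓ : S.IsCauchySurface Γ)
    (hbd : ∀ x : M, ∃ N : ℝ, ∀ (y : Γ) (γ : ℝ → M) (a b : ℝ), S.IsCausalCurve γ a b → γ a = x →
      γ b = y → S.length γ a b - φ y ≤ N)
    {x y₀ : M} (hy₀ : y₀ ∈ Γ) (hxy : S.Chron x y₀)
    {l : EuclideanSpace ℝ (Fin (n + 1)) →L[ℝ] ℝ}
    (hl : HasFDerivAt (fun e ↦ S.uSol Γ φ ((extChartAt (𝓡 (n + 1)) x).symm e)) l
        (extChartAt (𝓡 (n + 1)) x x))
    {G : EuclideanSpace ℝ (Fin (n + 1))} (hGl : ∀ v, S.form x G v = l v)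
    (hXG : 0 < S.form x (S.vec x) G) : -1 ≤ S.form x G G := by
  by_contra! hG
  have hnotΓ : ∀ z, S.Chron z y₀ → z ∉ Γ := fun z hz hzΓ ↦ hΓ.not_causLt hzΓ hy₀ hz.causLt
  obtain ⟨R, hR, κ, hκ, ρ, hρ1, hρ0, hsub, hRW, hlen⟩ := S.exists_length_le_of_lt_neg_one x hG hXG
    ((S.isOpen_chronPast_singleton y₀).mem_nhds hxy)
  simp only [hGl] at hlen
  set ψ := extChartAt (𝓡 (n + 1)) x with hψ
  -- The gap is at least `(1 - ρ) κ r = 4 δ r`, while linearization error and near-optimality cost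
  -- `δ r` each. The radius is therefore fixed before the curve is chosen.
  set δ := (1 - ρ) * κ / 4 with hδ
  have hδ0 : 0 < δ := by
    have : 0 < 1 - ρ := by linarith
    positivity
  have hlo := (hasFDerivAt_iff_isLittleO.1 hl).def hδ0
  obtain ⟨r', hr', hlin⟩ := Metric.eventually_nhds_iff_ball.1 hlo
  set r := min (R / 2) (r' / 2) with hr
  have hr0 : 0 < r := lt_min (by positivity) (by positivity)
  have hrR : r < R := (min_le_left _ _).trans_lt (by linarith)
  have hrr' : r < r' := (min_le_right _ _).trans_lt (by linarith)
  obtain ⟨y, γ, a, b, hγ, ha, hb, hlt⟩ := exists_lt_uSol_add (S := S) (φ := φ) (hnotΓ x hxy) hy₀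
    hxy.causLt (mul_pos hδ0 hr0)
  have hab : a < b := hγ.1
  have hnR : ∀ p ∈ chartBall (n := n) x R, p ∉ Γ := fun p hp ↦ hnotΓ p (hRW hp)
  have hax : γ a ∈ chartBall (n := n) x r := by
    rw [ha]
    exact mem_chartBall_self x hr0
  -- The ball lies in `I⁻(y₀)`, hence misses `Γ`, so the curve has to leave it.
  rcases exists_exit_time hrR hsub hγ.2.1 hax with
    hin | ⟨τ, hτ, hin, -, hsph⟩
  · have h1 := hin b (right_mem_Icc.2 hab.le)
    refine hnR (γ b) ⟨h1.1, Metric.ball_subset_ball hrR.le h1.2⟩ ?_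
    rw [hb]; exact y.2
  · have hτin := hin τ (right_mem_Icc.2 hτ.1.le)
    have hτb : τ < b := by
      refine lt_of_le_of_ne hτ.2 ?_
      rintro rfl
      exact hnR _ hτin (by rw [hb]; exact y.2)
    obtain ⟨h1, h2⟩ := hlen γ a τ (hγ.restrict le_rfl hτ.1 hτ.2) hin
    rw [ha] at h1 h2
    have h3 := IsPiecewiseC1With.length_add S hγ hτ.1.le hτ.2
    have h4 := uSol_le (hnR _ hτin) (hbd (γ τ)) (y := y) (hγ.restrict hτ.1.le hτb le_rfl) rfl hb
    have hnorm : ‖ψ (γ τ) - ψ x‖ = r := by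
      rw [← dist_eq_norm]; exact hsph
    have h5 := hlin (ψ (γ τ)) (by rw [mem_ball_iff_norm, hnorm]; exact hrr')
    have e1 : ψ.symm (ψ (γ τ)) = γ τ := ψ.left_inv hτin.1
    have e2 : ψ.symm (ψ x) = x := by simp [hψ]
    rw [e1, e2, hnorm, Real.norm_eq_abs] at h5
    have h6 := (abs_le.1 h5).1
    rw [hnorm] at h2
    have h7 : (1 - ρ) * (κ * r) ≤ (1 - ρ) * l (ψ (γ τ) - ψ x) :=
      mul_le_mul_of_nonneg_left h2 (by linarith)
    have h8 : (1 - ρ) * (κ * r) = 4 * (δ * r) := by rw [hδ]; ring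
    have h9 : 0 < δ * r := mul_pos hδ0 hr0
    linarith

end SpaceTime

/-! ### The eikonal equation -/

theorem mainTheorem6 {n : ℕ} {M : Type*} [TopologicalSpace M] [T2Space M]
    [SecondCountableTopology M] [ConnectedSpace M]
    [ChartedSpace (EuclideanSpace ℝ (Fin (n + 1))) M] [IsManifold (𝓡 (n + 1)) ∞ M]
    (S : SpaceTime n M) (hS : S.IsGloballyHyperbolic)
    (Γ : Set M) (hΓ : S.IsCauchySurface Γ)
    (h : ContMDiffRiemannianMetric (𝓡 (n + 1)) ∞ (EuclideanSpace ℝ (Fin (n + 1)))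
      (fun x : M ↦ TangentSpace (𝓡 (n + 1)) x))
    (φ : Γ → ℝ) (hφ : IsLocLipschitz h Γ φ)
    (x : M) (hx : x ∈ S.chronPast Γ)
    (hdiff : MDifferentiableAt (𝓡 (n + 1)) 𝓘(ℝ, ℝ) (S.uSol Γ φ) x) :
    S.IsTimelike (S.grad (S.uSol Γ φ) x) ∧
      S.IsPastDirected (S.grad (S.uSol Γ φ) x) ∧
      S.val x (S.grad (S.uSol Γ φ) x) (S.grad (S.uSol Γ φ) x) = -1 := by
  obtain ⟨y₀, hy₀, hxy⟩ := hx
  have hbd := SpaceTime.exists_forall_length_sub_le hS hΓ (hφ.exists_le hΓ)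
  obtain ⟨l, hl, hGl⟩ := SpaceTime.exists_hasFDerivAt (S := S) hdiff
  have hsqrt := fun V hV hXV ↦
    SpaceTime.sqrt_le_fderiv_uSol hΓ hbd hy₀ hxy hl (V := V) hV hXV
  have hX := S.form_vec_vec_neg x
  have hle : S.form x (S.grad (S.uSol Γ φ) x) (S.grad (S.uSol Γ φ) x) ≤ -1 :=
    (S.isLorentzForm_form x).le_neg_one_of_forall hX
      fun V hV hXV ↦ (hsqrt V hV hXV).trans_eq (hGl V).symm
  have hXG : 0 < S.form x (S.vec x) (S.grad (S.uSol Γ φ) x) := by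
    have h1 : S.form x (S.vec x) (S.grad (S.uSol Γ φ) x) = l (S.vec x) :=
      ((S.isLorentzForm_form x).1 _ _).trans (hGl _)
    rw [h1]
    -- The derivative inequality with `V = X` gives the time orientation of the gradient.
    exact (Real.sqrt_pos.2 (by linarith)).trans_le (hsqrt _ hX hX)
  have hge := SpaceTime.neg_one_le_of_hasFDerivAt_uSol hΓ hbd hy₀ hxy hl hGl hXG
  have heq : S.val x (S.grad (S.uSol Γ φ) x) (S.grad (S.uSol Γ φ) x) = -1 := le_antisymm hle hge
  have hneg : S.val x (S.grad (S.uSol Γ φ) x) (S.grad (S.uSol Γ φ) x) < 0 := by linarith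
  refine ⟨hneg, ⟨⟨?_, hneg.le⟩, hXG⟩, heq⟩
  intro h0
  rw [h0] at hneg
  simp at hneg
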